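/- Throughout, functions on $\mathbb{R}^n$ ($n\ge 1$) are complex-valued. For a measurable $f$ let $f^{*}(t)=\inf\{\alpha>0:\ |\{x:|f(x)|>\alpha\}|\le t\}$ be its decreasing rearrangement and, for $0<p,q\le\infty$, put $$\|f\|_{L^{p,q}}=\Big(\int_0^\infty\big(t^{1/p}f^{*}(t)\big)^q\,\frac{dt}{t}\Big)^{1/q}\ \text{ if } q<\infty,\qquad \|f\|_{L^{p,\infty}}=\sup_{t>0}t^{1/p}f^{*}(t),$$ with $1/\infty=0$; $L^{p,q}(\mathbb{R}^n)$ is the set of measurable $f$ with $\|f\|_{L^{p,q}}<\infty$. For $s>0$ and a Schwartz function $\varphi$, $\Lambda^s\varphi=(-\Delta)^{s/2}\varphi$ is given by $\widehat{\Lambda^s\varphi}(\xi)=|\xi|^s\widehat\varphi(\xi)$ (angular frequency $\xi$). For functions $u$ and $g$, with $g$ locally integrable, $\Lambda^su=g$ means that $\int_{\mathbb{R}^n} u\,\Lambda^s\varphi\,dx=\int_{\mathbb{R}^n} g\,\varphi\,dx$ for every Schwartz function $\varphi$, both integrals being absolutely convergent (such a $g$ is unique up to a null set); $u\in\dot H^s_{r,r_1}(\mathbb{R}^n)$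 means $\Lambda^su\in L^{r,r_1}(\mathbb{R}^n)$. **Proposition.** Let $n\ge 1$, $1<q,r\le\infty$, $1\le q_1,r_1\le\infty$ and $0<\sigma<s<\infty$, and let $p,p_1$ be given by $$\frac1p=\Big(1-\frac{\sigma}{s}\Big)\frac1q+\frac{\sigma}{s\,r},\qquad \frac1{p_1}=\Big(1-\frac{\sigma}{s}\Big)\frac1{q_1}+\frac{\sigma}{s\,r_1}.$$ Then there is a constant $C>0$, depending only on $q,r,q_1,r_1,s,\sigma$ and $n$, such that for every $u\in L^{q,q_1}(\mathbb{R}^n)\cap\dot H^s_{r,r_1}(\mathbb{R}^n)$ the distribution $\Lambda^\sigma u$ is a function in $L^{p,p_1}(\mathbb{R}^n)$ and $$\|\Lambda^\sigma u\|_{L^{p,p_1}}\le C\,\|u\|_{L^{q,q_1}}^{1-\sigma/s}\,\|\Lambda^su\|_{L^{r,r_1}}^{\sigma/s}.$$ -/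

import Mathlib

open MeasureTheory Set
open scoped ENNReal NNReal FourierTransform SchwartzMap

/-- The distribution function `α ↦ |{x : |f x| > α}|` of `f : ℝⁿ → ℂ` (Lebesgue measure). -/
noncomputable def distributionFn {n : ℕ} (f : EuclideanSpace ℝ (Fin n) → ℂ) (α : ℝ≥0) : ℝ≥0∞ :=
  volume {x | α < ‖f x‖₊}

/-- The decreasing rearrangement `f*(t) = inf {α > 0 : |{|f| > α}| ≤ t}`, with `inf ∅ = ∞`. -/
noncomputable def decreasingRearrangement {n : ℕ} (f : EuclideanSpace ℝ (Fin n) → ℂ)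
    (t : ℝ) : ℝ≥0∞ :=
  ⨅ (α : ℝ≥0) (_ : 0 < α) (_ : distributionFn f α ≤ ENNReal.ofReal t), (α : ℝ≥0∞)

/-- The Lorentz (quasi-)norm `‖f‖_{L^{p,q}(ℝⁿ)}`, for `0 < p, q ≤ ∞`, with values in `[0, ∞]`:
`(∫₀^∞ (t^{1/p} f*(t))^q dt/t)^{1/q}` if `q < ∞`, and `sup_{t > 0} t^{1/p} f*(t)` if `q = ∞`
(where `1/p = 0` for `p = ∞`). -/
noncomputable def lorentzNorm {n : ℕ} (f : EuclideanSpace ℝ (Fin n) → ℂ) (p q : ℝ≥0∞) : ℝ≥0∞ :=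
  if q = ∞ then
    ⨆ (t : ℝ) (_ : 0 < t), ENNReal.ofReal t ^ (p⁻¹).toReal * decreasingRearrangement f t
  else
    (∫⁻ t in Ioi (0 : ℝ),
      (ENNReal.ofReal t ^ (p⁻¹).toReal * decreasingRearrangement f t) ^ q.toReal
        / ENNReal.ofReal t) ^ (q⁻¹).toReal

/-- `f ∈ L^{p,q}(ℝⁿ)`. -/
def MemLorentz {n : ℕ} (f : EuclideanSpace ℝ (Fin n) → ℂ) (p q : ℝ≥0∞) : Prop :=
  AEStronglyMeasurable f volume ∧ lorentzNorm f p q < ∞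

/-- `Λ^s φ = (-Δ)^{s/2} φ` for a Schwartz function `φ`: the Fourier multiplier with symbol `|ξ|^s`
in the angular frequency. Mathlib's Fourier transform is
`𝓕 φ ξ = ∫ exp (-2πi ⟪x, ξ⟫) φ x dx`, so that the symbol is `(2π|ξ|)^s` in its variable. -/
noncomputable def schwartzLambda {n : ℕ} (s : ℝ) (φ : 𝓢(EuclideanSpace ℝ (Fin n), ℂ)) :
    EuclideanSpace ℝ (Fin n) → ℂ :=
  𝓕⁻ (fun ξ : EuclideanSpace ℝ (Fin n) =>
    (((2 * Real.pi * ‖ξ‖) ^ s : ℝ) : ℂ) * 𝓕 (φ : EuclideanSpace ℝ (Fin n) → ℂ) ξ)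

/-- `Λ^s u = g` in the sense of tempered distributions, `u` and `g` functions on `ℝⁿ`: the
(bilinear) duality pairings satisfy `⟨u, Λ^s φ⟩ = ⟨g, φ⟩` for all Schwartz functions `φ`,
both of them being absolutely convergent integrals. As `g` is locally integrable, it is determined
by `u` and `s` up to a null set. -/
def IsLambda {n : ℕ} (s : ℝ) (u g : EuclideanSpace ℝ (Fin n) → ℂ) : Prop :=
  LocallyIntegrable g volume ∧
    ∀ φ : 𝓢(EuclideanSpace ℝ (Fin n), ℂ),
      Integrable (fun x => u x * schwartzLambda s φ x) volume ∧
      Integrable (fun x => g x * φ x) volume ∧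
      ∫ x, u x * schwartzLambda s φ x = ∫ x, g x * φ x

/-!
The inequality is first proved for the K-functional of the couple `(L¹, L^∞)`,
`K(τ, f) = ∫₀^τ f* = sup {∫ w |f| : 0 ≤ w ≤ 1, ∫ w ≤ τ}`, at every `τ` separately.

*Splitting of the symbol.* For integrable kernels `K`, `L` one has `|ξ|^σ = 𝓕 K + |ξ|^s 𝓕 L`
(`exists_fourier_splitting`). With a smooth `χ` supported in an annulus and
`c |ξ|^{σ-s} = ∫₀^∞ t^{s-σ-1} χ(t|ξ|) dt`, the part `t ≤ 1` of the integral gives `L` and the part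
`t > 1` gives `K`: both are superpositions of `L¹`-normalised dilates of Schwartz functions with an
integrable weight. Dilating by `A` gives formally `Λ^σ u = A^{-σ} K_A * u + A^{s-σ} L_A * Λ^s u`,
where the `L¹` norms of `K_A` and `L_A` do not depend on `A`. The same splitting, with an even
integer in place of `s`, shows that `Λ^σ φ` is integrable and bounded for Schwartz `φ`, so that all
pairings converge absolutely. The right-hand side for a given `A` is `intermediateDerivative`, and
`isLambda_intermediateDerivative` shows that it represents `Λ^σ u`; by uniqueness
(`IsLambda.ae_eq`) it does not depend on `A`, up to null sets.

*Interpolation at fixed `τ`.* The K-functional is subadditive and translation invariant, so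
`K(τ, Λ^σ u) ≤ A^{-σ} ‖K‖₁ K(τ, u) + A^{s-σ} ‖L‖₁ K(τ, Λ^s u)` for every `A > 0`. Optimising in `A`,
for each `τ` separately, gives `K(τ, Λ^σ u) ≤ C K(τ, u)^{1-σ/s} K(τ, Λ^s u)^{σ/s}`.

*Return to Lorentz norms.* Since `τ f*(τ) ≤ K(τ, f) ≤ ∫₀^τ f*`, the theorem follows from Hölder's
inequality for the measure `dt/t` (`haarNorm_mul_rpow_le`) and from Hardy's inequality
(`haarNorm_average_le`), the latter requiring `q, r > 1`.
-/

/-! ### Weighted norms on the half-line -/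

/-- The norm of `L^q((0, ∞), dt/t)`, with a genuine supremum (not an essential one) for `q = ∞`. -/
noncomputable def haarNorm (G : ℝ → ℝ≥0∞) (q : ℝ≥0∞) : ℝ≥0∞ :=
  if q = ∞ then ⨆ (t : ℝ) (_ : 0 < t), G t
  else (∫⁻ t in Ioi (0 : ℝ), G t ^ q.toReal / ENNReal.ofReal t) ^ (q⁻¹).toReal

lemma lorentzNorm_eq_haarNorm {n : ℕ} (f : EuclideanSpace ℝ (Fin n) → ℂ) (p q : ℝ≥0∞) :
    lorentzNorm f p q =
      haarNorm (fun t => ENNReal.ofReal t ^ (p⁻¹).toReal * decreasingRearrangement f t) q :=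
  rfl

lemma haarNorm_mono {G H : ℝ → ℝ≥0∞} (q : ℝ≥0∞) (h : ∀ t, 0 < t → G t ≤ H t) :
    haarNorm G q ≤ haarNorm H q := by
  unfold haarNorm
  split_ifs
  · exact iSup₂_mono h
  · gcongr ?_ ^ _
    refine setLIntegral_mono' measurableSet_Ioi fun t ht => ?_
    gcongr
    exact h t ht

lemma haarNorm_const_mul {G : ℝ → ℝ≥0∞} {q : ℝ≥0∞} (hq : 1 ≤ q) {c : ℝ≥0∞} (hc : c ≠ ∞) :
    haarNorm (fun t => c * G t) q = c * haarNorm G q := by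
  unfold haarNorm
  split_ifs with h
  · simp_rw [ENNReal.mul_iSup]
  · have hq0 : q.toReal ≠ 0 := (ENNReal.toReal_pos (by positivity) h).ne'
    have : ∀ t, (c * G t) ^ q.toReal / ENNReal.ofReal t
        = c ^ q.toReal * (G t ^ q.toReal / ENNReal.ofReal t) := fun t => by
      rw [ENNReal.mul_rpow_of_nonneg _ _ ENNReal.toReal_nonneg, mul_div_assoc]
    simp_rw [this]
    rw [lintegral_const_mul' _ _ (ENNReal.rpow_ne_top_of_nonneg ENNReal.toReal_nonneg hc),
      ENNReal.mul_rpow_of_nonneg _ _ ENNReal.toReal_nonneg, ← ENNReal.rpow_mul,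
      ENNReal.toReal_inv, mul_inv_cancel₀ hq0, ENNReal.rpow_one]

lemma lintegral_comp_mul_left (F : ℝ → ℝ≥0∞) (hF : Measurable F) {c : ℝ} (hc : 0 < c) :
    ENNReal.ofReal c * ∫⁻ t, F (c * t) = ∫⁻ t, F t := by
  rw [← lintegral_map hF (measurable_const_mul c), Real.map_volume_mul_left hc.ne',
    lintegral_smul_measure, smul_eq_mul, ← mul_assoc, ← ENNReal.ofReal_mul hc.le,
    abs_of_pos (inv_pos.2 hc), mul_inv_cancel₀ hc.ne']
  simp

/-- Dilation invariance of the measure `dt/t`. -/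
lemma lintegral_comp_mul_left_div (F : ℝ → ℝ≥0∞) (hF : Measurable F) {c : ℝ} (hc : 0 < c) :
    ∫⁻ t in Ioi (0 : ℝ), F (c * t) / ENNReal.ofReal t
      = ∫⁻ t in Ioi (0 : ℝ), F t / ENNReal.ofReal t := by
  rw [← lintegral_indicator measurableSet_Ioi, ← lintegral_indicator measurableSet_Ioi,
    ← lintegral_comp_mul_left ((Ioi (0 : ℝ)).indicator fun t => F t / ENNReal.ofReal t)
      ((hF.div ENNReal.measurable_ofReal).indicator measurableSet_Ioi) hc,
    ← lintegral_const_mul' _ _ ENNReal.ofReal_ne_top]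
  refine lintegral_congr fun t => ?_
  by_cases ht : 0 < t
  · rw [indicator_of_mem (by exact ht), indicator_of_mem (by exact mul_pos hc ht),
      ENNReal.ofReal_mul hc.le, div_eq_mul_inv, div_eq_mul_inv,
      ENNReal.mul_inv (by simp [hc]) (by simp)]
    calc _ = ENNReal.ofReal c * (ENNReal.ofReal c)⁻¹ * (F (c * t) * (ENNReal.ofReal t)⁻¹) := by
            rw [ENNReal.mul_inv_cancel (by simp [hc]) (by simp), one_mul]
      _ = _ := by ring
  · rw [indicator_of_notMem (by exact ht), indicator_of_notMem, mul_zero]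
    simp only [mem_Ioi, not_lt] at ht ⊢
    exact mul_nonpos_of_nonneg_of_nonpos hc.le ht

/-- Hölder's inequality for the interpolation of two weighted norms. -/
lemma haarNorm_mul_rpow_le {G H : ℝ → ℝ≥0∞} (hG : Measurable G) (hH : Measurable H)
    {q₁ r₁ p₁ : ℝ≥0∞} (hq : 1 ≤ q₁) (hr : 1 ≤ r₁) {θ : ℝ} (h0 : 0 < θ) (h1 : θ < 1)
    (hp : p₁⁻¹ = ENNReal.ofReal (1 - θ) * q₁⁻¹ + ENNReal.ofReal θ * r₁⁻¹) :
    haarNorm (fun t => G t ^ (1 - θ) * H t ^ θ) p₁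
      ≤ haarNorm G q₁ ^ (1 - θ) * haarNorm H r₁ ^ θ := by
  have h1' : 0 < 1 - θ := by linarith
  have hq' : q₁⁻¹ ≠ ∞ := by simp; positivity
  have hr' : r₁⁻¹ ≠ ∞ := by simp; positivity
  have hpR : (p₁⁻¹).toReal = (1 - θ) * (q₁⁻¹).toReal + θ * (r₁⁻¹).toReal := by
    rw [hp, ENNReal.toReal_add (ENNReal.mul_ne_top (by simp) hq')
      (ENNReal.mul_ne_top (by simp) hr'), ENNReal.toReal_mul, ENNReal.toReal_mul,
      ENNReal.toReal_ofReal h1'.le, ENNReal.toReal_ofReal h0.le]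
  have hp' : p₁⁻¹ ≠ ∞ := by
    rw [hp]
    exact ENNReal.add_ne_top.2 ⟨ENNReal.mul_ne_top (by simp) hq', ENNReal.mul_ne_top (by simp) hr'⟩
  have hp0 : p₁ ≠ 0 := by simpa using hp'
  have htop : p₁ = ∞ ↔ q₁ = ∞ ∧ r₁ = ∞ := by
    rw [← ENNReal.inv_eq_zero, hp]
    simp [h1.not_ge, h0.not_ge]
  by_cases hpt : p₁ = ∞
  · obtain ⟨rfl, rfl⟩ := htop.1 hpt
    simp only [haarNorm, hpt, if_true]
    refine iSup₂_le fun t ht => ?_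
    gcongr
    · exact le_iSup₂ (f := fun t (_ : 0 < t) => G t) t ht
    · exact le_iSup₂ (f := fun t (_ : 0 < t) => H t) t ht
  have hP : 0 < p₁.toReal := ENNReal.toReal_pos hp0 hpt
  have hPi : (p₁⁻¹).toReal = (p₁.toReal)⁻¹ := ENNReal.toReal_inv _
  -- When one of the exponents is infinite, its factor is pulled out of the integral.
  have aux : ∀ (G H : ℝ → ℝ≥0∞), Measurable H → ∀ (r₁ : ℝ≥0∞) (θ : ℝ), 0 < θ → θ < 1 →
      r₁ ≠ 0 → r₁ ≠ ∞ → (p₁⁻¹).toReal = θ * (r₁⁻¹).toReal →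
      haarNorm (fun t => G t ^ (1 - θ) * H t ^ θ) p₁
        ≤ haarNorm G ∞ ^ (1 - θ) * haarNorm H r₁ ^ θ := by
    intro G H hH r₁ θ h0 h1 hr0 hrt hpr
    have hR : 0 < r₁.toReal := ENNReal.toReal_pos hr0 hrt
    have hθP : θ * p₁.toReal = r₁.toReal := by
      rw [hPi, ENNReal.toReal_inv] at hpr
      field_simp at hpr
      linarith
    simp only [haarNorm, hpt, hrt, if_false, if_true]
    set S := ⨆ (t : ℝ) (_ : 0 < t), G t
    calc _ ≤ (∫⁻ t in Ioi (0 : ℝ), S ^ ((1 - θ) * p₁.toReal) *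
          (H t ^ r₁.toReal / ENNReal.ofReal t)) ^ (p₁⁻¹).toReal := by
          gcongr ?_ ^ _
          refine setLIntegral_mono' measurableSet_Ioi fun t ht => ?_
          rw [ENNReal.mul_rpow_of_nonneg _ _ hP.le, ← ENNReal.rpow_mul, ← ENNReal.rpow_mul, hθP,
            mul_div_assoc]
          have : 0 ≤ (1 - θ) * p₁.toReal := mul_nonneg (by linarith) hP.le
          gcongr
          exact le_iSup₂ (f := fun t (_ : 0 < t) => G t) t ht
      _ = _ := by
          have hm : Measurable fun t => H t ^ r₁.toReal / ENNReal.ofReal t :=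
            (hH.pow_const _).div ENNReal.measurable_ofReal
          rw [lintegral_const_mul _ hm, ENNReal.mul_rpow_of_nonneg _ _ ENNReal.toReal_nonneg, ← ENNReal.rpow_mul,
            ← ENNReal.rpow_mul, hPi, mul_assoc, mul_inv_cancel₀ hP.ne', mul_one,
            ← hPi, hpr, mul_comm θ]
  by_cases hqt : q₁ = ∞
  · subst hqt
    have hrt : r₁ ≠ ∞ := fun h => hpt (htop.2 ⟨rfl, h⟩)
    exact aux G H hH r₁ θ h0 h1 (by positivity) hrt (by simpa using hpR)
  by_cases hrt : r₁ = ∞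
  · subst hrt
    have := aux H G hG q₁ (1 - θ) h1' (by linarith) (by positivity) hqt (by simpa using hpR)
    simpa [mul_comm] using this
  have hQ : 0 < q₁.toReal := ENNReal.toReal_pos (by positivity) hqt
  have hR : 0 < r₁.toReal := ENNReal.toReal_pos (by positivity) hrt
  rw [ENNReal.toReal_inv, ENNReal.toReal_inv, ENNReal.toReal_inv] at hpR
  simp only [haarNorm, hpt, hqt, hrt, if_false]
  set a := (1 - θ) * p₁.toReal / q₁.toReal with ha
  set b := θ * p₁.toReal / r₁.toReal with hb
  have ha0 : 0 ≤ a := by positivity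
  have hb0 : 0 ≤ b := by positivity
  have hab : a + b = 1 := by
    have : a + b = p₁.toReal * ((1 - θ) * (q₁.toReal)⁻¹ + θ * (r₁.toReal)⁻¹) := by
      rw [ha, hb]; ring
    rw [this, ← hpR, mul_inv_cancel₀ hP.ne']
  calc _ = (∫⁻ t in Ioi (0 : ℝ), (G t ^ q₁.toReal / ENNReal.ofReal t) ^ a *
          (H t ^ r₁.toReal / ENNReal.ofReal t) ^ b) ^ (p₁⁻¹).toReal := by
        congr 1
        refine setLIntegral_congr_fun measurableSet_Ioi fun t ht => ?_
        have ht0 : ENNReal.ofReal t ≠ 0 := by simpa using ht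
        simp only [div_eq_mul_inv]
        rw [ENNReal.mul_rpow_of_nonneg _ _ hP.le, ENNReal.mul_rpow_of_nonneg _ _ ha0,
          ENNReal.mul_rpow_of_nonneg _ _ hb0]
        simp only [← ENNReal.rpow_mul]
        have e1 : q₁.toReal * a = (1 - θ) * p₁.toReal := by rw [ha]; field_simp
        have e2 : r₁.toReal * b = θ * p₁.toReal := by rw [hb]; field_simp
        rw [e1, e2]
        have : (ENNReal.ofReal t)⁻¹ = (ENNReal.ofReal t)⁻¹ ^ a * (ENNReal.ofReal t)⁻¹ ^ b := by
          rw [← ENNReal.rpow_add_of_nonneg _ _ ha0 hb0, hab, ENNReal.rpow_one]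
        nth_rewrite 1 [this]
        ring
    _ ≤ ((∫⁻ t in Ioi (0 : ℝ), G t ^ q₁.toReal / ENNReal.ofReal t) ^ a *
          (∫⁻ t in Ioi (0 : ℝ), H t ^ r₁.toReal / ENNReal.ofReal t) ^ b) ^ (p₁⁻¹).toReal := by
        gcongr ?_ ^ _
        exact ENNReal.lintegral_mul_norm_pow_le
          ((hG.pow_const _).div ENNReal.measurable_ofReal).aemeasurable
          ((hH.pow_const _).div ENNReal.measurable_ofReal).aemeasurable ha0 hb0 hab
    _ = _ := by
        rw [ENNReal.mul_rpow_of_nonneg _ _ ENNReal.toReal_nonneg]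
        simp only [← ENNReal.rpow_mul, ENNReal.toReal_inv]
        have e1 : a * p₁.toReal⁻¹ = q₁.toReal⁻¹ * (1 - θ) := by rw [ha]; field_simp
        have e2 : b * p₁.toReal⁻¹ = r₁.toReal⁻¹ * θ := by rw [hb]; field_simp
        rw [e1, e2]

lemma lintegral_rpow_neg_lt_top {β : ℝ} (hβ : β < 1) :
    ∫⁻ l in Ioo (0 : ℝ) 1, ENNReal.ofReal l ^ (-β) < ∞ := by
  have h : IntegrableOn (fun x : ℝ => x ^ (-β)) (Ioo 0 1) :=
    (intervalIntegral.integrableOn_Ioo_rpow_iff (by norm_num)).2 (by linarith)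
  refine lt_of_eq_of_lt ?_ h.2
  refine setLIntegral_congr_fun measurableSet_Ioo fun l hl => ?_
  rw [ENNReal.ofReal_rpow_of_pos hl.1, Real.enorm_of_nonneg (Real.rpow_nonneg hl.1.le _)]

/-- Hardy's inequality: averaging over `(0, t)` is bounded for the norm `‖t^β F‖_{L^q(dt/t)}`,
`β < 1`. With the average written as `∫₀¹ F(λt) dλ`, it is Jensen's inequality for the finite
measure `λ^{-β} dλ`, followed by Tonelli's theorem and the dilation invariance of `dt/t`. -/
lemma haarNorm_average_le {F : ℝ → ℝ≥0∞} (hF : Measurable F) {q : ℝ≥0∞} (hq : 1 ≤ q) {β : ℝ}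
    (hβ : β < 1) :
    haarNorm (fun t => ENNReal.ofReal t ^ β * ∫⁻ l in Ioo (0 : ℝ) 1, F (l * t)) q
      ≤ (∫⁻ l in Ioo (0 : ℝ) 1, ENNReal.ofReal l ^ (-β)) *
        haarNorm (fun t => ENNReal.ofReal t ^ β * F t) q := by
  set c := ∫⁻ l in Ioo (0 : ℝ) 1, ENNReal.ofReal l ^ (-β) with hc
  have hct : c < ∞ := lintegral_rpow_neg_lt_top hβ
  set G : ℝ → ℝ≥0∞ := fun t => ENNReal.ofReal t ^ β * F t with hG
  have hGm : Measurable G := (ENNReal.measurable_ofReal.pow_const _).mul hF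
  have hU : ∀ t, 0 < t → ENNReal.ofReal t ^ β * ∫⁻ l in Ioo (0 : ℝ) 1, F (l * t)
      = ∫⁻ l in Ioo (0 : ℝ) 1, ENNReal.ofReal l ^ (-β) * G (l * t) := by
    intro t ht
    have hm : Measurable fun l : ℝ => F (l * t) := hF.comp (measurable_id.mul_const t)
    rw [← lintegral_const_mul _ hm]
    refine setLIntegral_congr_fun measurableSet_Ioo fun l hl => ?_
    have hl0 : ENNReal.ofReal l ≠ 0 := by simpa using hl.1
    simp only [hG]
    rw [ENNReal.ofReal_mul hl.1.le, ENNReal.mul_rpow_of_ne_top (by simp) (by simp), ← mul_assoc,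
      ← mul_assoc, ← ENNReal.rpow_add _ _ hl0 (by simp), neg_add_cancel, ENNReal.rpow_zero, one_mul]
  refine (haarNorm_mono q (fun t ht => (hU t ht).le)).trans ?_
  unfold haarNorm
  split_ifs with h
  · refine iSup₂_le fun t ht => ?_
    rw [hc, ← lintegral_mul_const _ (ENNReal.measurable_ofReal.pow_const _)]
    refine setLIntegral_mono' measurableSet_Ioo fun l hl => ?_
    gcongr
    exact le_iSup₂ (f := fun t (_ : 0 < t) => G t) (l * t) (mul_pos hl.1 ht)
  · have hQ : 1 ≤ q.toReal := by
      simpa using ENNReal.toReal_mono h hq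
    have hQ0 : 0 < q.toReal := by linarith
    have hQi : q.toReal⁻¹ ≤ 1 := inv_le_one_of_one_le₀ hQ
    set Q := q.toReal with hQdef
    have hwm : Measurable fun l : ℝ => ENNReal.ofReal l ^ (-β) :=
      ENNReal.measurable_ofReal.pow_const _
    have jensen : ∀ t, (∫⁻ l in Ioo (0 : ℝ) 1, ENNReal.ofReal l ^ (-β) * G (l * t)) ^ Q
        ≤ c ^ (Q - 1) * ∫⁻ l in Ioo (0 : ℝ) 1, ENNReal.ofReal l ^ (-β) * G (l * t) ^ Q := by
      intro t
      have := ENNReal.lintegral_mul_norm_pow_le (μ := volume.restrict (Ioo (0 : ℝ) 1))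
        (f := fun l => ENNReal.ofReal l ^ (-β) * G (l * t) ^ Q)
        (g := fun l => ENNReal.ofReal l ^ (-β))
        (hwm.mul ((hGm.comp (measurable_id.mul_const t)).pow_const _)).aemeasurable
        hwm.aemeasurable (p := Q⁻¹) (q := 1 - Q⁻¹) (by positivity) (by linarith) (by ring)
      have e : ∀ l : ℝ, (ENNReal.ofReal l ^ (-β) * G (l * t) ^ Q) ^ Q⁻¹ *
          (ENNReal.ofReal l ^ (-β)) ^ (1 - Q⁻¹) = ENNReal.ofReal l ^ (-β) * G (l * t) := by
        intro l
        rw [ENNReal.mul_rpow_of_nonneg _ _ (by positivity), ← ENNReal.rpow_mul (G (l * t)),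
          mul_inv_cancel₀ hQ0.ne', ENNReal.rpow_one, mul_right_comm,
          ← ENNReal.rpow_add_of_nonneg _ _ (by positivity) (by linarith)]
        simp
      simp_rw [e] at this
      calc _ ≤ _ := ENNReal.rpow_le_rpow this hQ0.le
        _ = _ := by
          rw [ENNReal.mul_rpow_of_nonneg _ _ hQ0.le, ← ENNReal.rpow_mul, ← ENNReal.rpow_mul,
            inv_mul_cancel₀ hQ0.ne', ENNReal.rpow_one, mul_comm, sub_mul,
            inv_mul_cancel₀ hQ0.ne', one_mul]
    have hm2 : Measurable fun z : ℝ × ℝ => ENNReal.ofReal z.1 ^ (-β) * G (z.1 * z.2) ^ Q :=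
      (hwm.comp measurable_fst).mul
        ((hGm.comp (measurable_fst.mul measurable_snd)).pow_const _)
    have main : ∫⁻ t in Ioi (0 : ℝ),
        (∫⁻ l in Ioo (0 : ℝ) 1, ENNReal.ofReal l ^ (-β) * G (l * t)) ^ Q / ENNReal.ofReal t
        ≤ c ^ Q * ∫⁻ t in Ioi (0 : ℝ), G t ^ Q / ENNReal.ofReal t := by
      calc _ ≤ ∫⁻ t in Ioi (0 : ℝ), c ^ (Q - 1) * ∫⁻ l in Ioo (0 : ℝ) 1,
            ENNReal.ofReal l ^ (-β) * (G (l * t) ^ Q / ENNReal.ofReal t) := by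
            refine setLIntegral_mono' measurableSet_Ioi fun t ht => ?_
            have ht0 : (ENNReal.ofReal t)⁻¹ ≠ ∞ := by simpa using ht
            calc _ ≤ _ := ENNReal.div_le_div_right (jensen t) _
              _ = _ := by
                simp only [div_eq_mul_inv]
                rw [mul_assoc, ← lintegral_mul_const' _ _ ht0]
                simp only [mul_assoc]
        _ = c ^ (Q - 1) * ∫⁻ l in Ioo (0 : ℝ) 1, ∫⁻ t in Ioi (0 : ℝ),
            ENNReal.ofReal l ^ (-β) * (G (l * t) ^ Q / ENNReal.ofReal t) := by
            have hct' : c ^ (Q - 1) ≠ ∞ := ENNReal.rpow_ne_top_of_nonneg (by linarith) hct.ne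
            rw [lintegral_const_mul' _ _ hct', lintegral_lintegral_swap]
            simp only [Function.uncurry_def, ← mul_div_assoc]
            exact ((hm2.comp measurable_swap).div
              (ENNReal.measurable_ofReal.comp measurable_fst)).aemeasurable
        _ = c ^ (Q - 1) * (c * ∫⁻ t in Ioi (0 : ℝ), G t ^ Q / ENNReal.ofReal t) := by
            rw [hc, ← lintegral_mul_const _ hwm]
            congr 1
            refine setLIntegral_congr_fun measurableSet_Ioo fun l hl => ?_
            rw [lintegral_const_mul, lintegral_comp_mul_left_div (fun t => G t ^ Q)
              (hGm.pow_const _) hl.1]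
            exact ((hGm.comp (measurable_const_mul l)).pow_const _).div ENNReal.measurable_ofReal
        _ = _ := by
            rw [← mul_assoc]
            nth_rewrite 2 [← ENNReal.rpow_one c]
            rw [← ENNReal.rpow_add_of_nonneg _ _ (by linarith) zero_le_one, sub_add_cancel]
    calc _ ≤ _ := ENNReal.rpow_le_rpow main ENNReal.toReal_nonneg
      _ = _ := by
        rw [ENNReal.mul_rpow_of_nonneg _ _ ENNReal.toReal_nonneg, ← ENNReal.rpow_mul,
          ENNReal.toReal_inv, mul_inv_cancel₀ hQ0.ne', ENNReal.rpow_one]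

/-! ### The K-functional of the couple `(L¹, L^∞)` -/

/-- The K-functional of the couple `(L¹, L^∞)`, written as the supremum of `∫ w |f|` over the
weights `0 ≤ w ≤ 1` with `∫ w ≤ τ`. It equals `∫₀^τ f*`; the supremum is the form in which
subadditivity and translation invariance are evident. -/
noncomputable def kFunctional {n : ℕ} (f : EuclideanSpace ℝ (Fin n) → ℂ) (τ : ℝ≥0∞) : ℝ≥0∞ :=
  ⨆ (w : EuclideanSpace ℝ (Fin n) → ℝ≥0∞) (_ : AEMeasurable w) (_ : ∀ x, w x ≤ 1)
    (_ : ∫⁻ x, w x ≤ τ), ∫⁻ x, w x * ‖f x‖ₑ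

section KFunctional

variable {n : ℕ} {f g : EuclideanSpace ℝ (Fin n) → ℂ}

lemma le_kFunctional (f : EuclideanSpace ℝ (Fin n) → ℂ) {τ : ℝ≥0∞}
    {w : EuclideanSpace ℝ (Fin n) → ℝ≥0∞} (hw : AEMeasurable w) (h1 : ∀ x, w x ≤ 1)
    (hτ : ∫⁻ x, w x ≤ τ) : ∫⁻ x, w x * ‖f x‖ₑ ≤ kFunctional f τ :=
  le_iSup_of_le w (le_iSup_of_le hw (le_iSup_of_le h1 (le_iSup_of_le hτ le_rfl)))

lemma kFunctional_le {τ B : ℝ≥0∞}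
    (h : ∀ w : EuclideanSpace ℝ (Fin n) → ℝ≥0∞, AEMeasurable w → (∀ x, w x ≤ 1) →
      ∫⁻ x, w x ≤ τ → ∫⁻ x, w x * ‖f x‖ₑ ≤ B) : kFunctional f τ ≤ B :=
  iSup_le fun w => iSup_le fun hw => iSup_le fun h1 => iSup_le fun hτ => h w hw h1 hτ

lemma kFunctional_mono (f : EuclideanSpace ℝ (Fin n) → ℂ) {τ τ' : ℝ≥0∞} (h : τ ≤ τ') :
    kFunctional f τ ≤ kFunctional f τ' :=
  kFunctional_le fun _ hw h1 hτ => le_kFunctional f hw h1 (hτ.trans h)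

lemma kFunctional_congr_ae (h : f =ᵐ[volume] g) (τ : ℝ≥0∞) :
    kFunctional f τ = kFunctional g τ := by
  unfold kFunctional
  have : ∀ w : EuclideanSpace ℝ (Fin n) → ℝ≥0∞,
      ∫⁻ x, w x * ‖f x‖ₑ = ∫⁻ x, w x * ‖g x‖ₑ := fun w =>
    lintegral_congr_ae (by filter_upwards [h] with x hx; rw [hx])
  simp_rw [this]

lemma kFunctional_add_le (hf : AEStronglyMeasurable f) (τ : ℝ≥0∞) :
    kFunctional (fun x => f x + g x) τ ≤ kFunctional f τ + kFunctional g τ := by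
  refine kFunctional_le fun w hw h1 hτ => ?_
  calc ∫⁻ x, w x * ‖f x + g x‖ₑ ≤ ∫⁻ x, (w x * ‖f x‖ₑ + w x * ‖g x‖ₑ) := by
        refine lintegral_mono fun x => ?_
        rw [← mul_add]
        gcongr
        exact enorm_add_le _ _
    _ = (∫⁻ x, w x * ‖f x‖ₑ) + ∫⁻ x, w x * ‖g x‖ₑ := lintegral_add_left' (hw.mul hf.enorm) _
    _ ≤ _ := add_le_add (le_kFunctional f hw h1 hτ) (le_kFunctional g hw h1 hτ)

lemma kFunctional_const_mul_le (c : ℂ) (f : EuclideanSpace ℝ (Fin n) → ℂ) (τ : ℝ≥0∞) :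
    kFunctional (fun x => c * f x) τ ≤ ‖c‖ₑ * kFunctional f τ := by
  refine kFunctional_le fun w hw h1 hτ => ?_
  calc ∫⁻ x, w x * ‖c * f x‖ₑ = ∫⁻ x, ‖c‖ₑ * (w x * ‖f x‖ₑ) := by
        simp_rw [enorm_mul, mul_left_comm]
    _ = ‖c‖ₑ * ∫⁻ x, w x * ‖f x‖ₑ := lintegral_const_mul' _ _ enorm_ne_top
    _ ≤ _ := by gcongr; exact le_kFunctional f hw h1 hτ

/-- A bounded integrable weight pairs with every function with finite K-functional, with a bound
that only involves the size of the weight. -/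
lemma lintegral_mul_enorm_le_kFunctional (f : EuclideanSpace ℝ (Fin n) → ℂ)
    {v : EuclideanSpace ℝ (Fin n) → ℝ≥0∞} (hv : AEMeasurable v) {B : ℝ≥0} (hB : 0 < B)
    (hvB : ∀ x, v x ≤ B) :
    ∫⁻ x, v x * ‖f x‖ₑ ≤ B * kFunctional f ((B : ℝ≥0∞)⁻¹ * ∫⁻ x, v x) := by
  have hB0 : (B : ℝ≥0∞) ≠ 0 := by simpa using hB.ne'
  calc ∫⁻ x, v x * ‖f x‖ₑ = ∫⁻ x, B * (((B : ℝ≥0∞)⁻¹ * v x) * ‖f x‖ₑ) := by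
        refine lintegral_congr fun x => ?_
        rw [← mul_assoc, ← mul_assoc, ENNReal.mul_inv_cancel hB0 (by simp), one_mul]
    _ = B * ∫⁻ x, ((B : ℝ≥0∞)⁻¹ * v x) * ‖f x‖ₑ := lintegral_const_mul' _ _ (by simp)
    _ ≤ _ := by
        gcongr
        refine le_kFunctional f (hv.const_mul _) (fun x => ?_) ?_
        · calc (B : ℝ≥0∞)⁻¹ * v x ≤ (B : ℝ≥0∞)⁻¹ * B := by gcongr; exact hvB x
            _ = 1 := ENNReal.inv_mul_cancel hB0 (by simp)
        · rw [lintegral_const_mul' _ _ (by simpa using hB0)]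

lemma locallyIntegrable_of_kFunctional_lt_top (hf : AEStronglyMeasurable f)
    (h : ∀ τ : ℝ≥0∞, τ ≠ ∞ → kFunctional f τ < ∞) : LocallyIntegrable f := by
  rw [locallyIntegrable_iff]
  intro S hS
  refine ⟨hf.restrict, ?_⟩
  have := le_kFunctional f (w := S.indicator 1)
    (measurable_one.indicator hS.measurableSet).aemeasurable
    (fun x => indicator_le_self' (by simp) x) le_rfl
  refine lt_of_le_of_lt ?_ (this.trans_lt (h _ ?_))
  · rw [← lintegral_indicator hS.measurableSet]
    refine lintegral_mono fun x => ?_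
    by_cases hx : x ∈ S <;> simp [hx]
  · rw [lintegral_indicator_one hS.measurableSet]
    exact hS.measure_lt_top.ne

/-! ### Comparison with the decreasing rearrangement -/

lemma decreasingRearrangement_antitone (f : EuclideanSpace ℝ (Fin n) → ℂ) :
    Antitone (decreasingRearrangement f) := by
  intro s t hst
  refine le_iInf fun a => le_iInf fun ha => le_iInf fun hd => ?_
  exact iInf_le_of_le a (iInf_le_of_le ha
    (iInf_le_of_le (hd.trans (ENNReal.ofReal_le_ofReal hst)) le_rfl))

lemma decreasingRearrangement_measurable (f : EuclideanSpace ℝ (Fin n) → ℂ) :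
    Measurable (decreasingRearrangement f) :=
  (decreasingRearrangement_antitone f).measurable

lemma distributionFn_antitone (f : EuclideanSpace ℝ (Fin n) → ℂ) :
    Antitone (distributionFn f) := fun _ _ hab =>
  measure_mono fun _ hx => lt_of_le_of_lt hab hx

lemma lt_distributionFn_of_lt {t : ℝ} {a : ℝ≥0} (ha : 0 < a)
    (h : (a : ℝ≥0∞) < decreasingRearrangement f t) : ENNReal.ofReal t < distributionFn f a := by
  by_contra! hd
  exact h.not_ge (iInf_le_of_le a (iInf_le_of_le ha (iInf_le_of_le hd le_rfl)))

lemma le_decreasingRearrangement_of_lt {t : ℝ} {a : ℝ≥0}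
    (h : ENNReal.ofReal t < distributionFn f a) : (a : ℝ≥0∞) ≤ decreasingRearrangement f t := by
  refine le_iInf fun b => le_iInf fun _ => le_iInf fun hd => ?_
  rw [ENNReal.coe_le_coe]
  by_contra! hb
  exact (h.trans_le ((distributionFn_antitone f hb.le).trans hd)).false

/-- The lower bound of the K-functional: if `a < f*(t)`, then `{|f| > a}` has a subset `T` of finite
measure larger than `t`, and the weight `t / |T|` on `T` is admissible. -/
lemma mul_decreasingRearrangement_le_kFunctional (hf : AEStronglyMeasurable f) {t : ℝ}
    (ht : 0 < t) :
    ENNReal.ofReal t * decreasingRearrangement f t ≤ kFunctional f (ENNReal.ofReal t) := by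
  have ht0 : ENNReal.ofReal t ≠ 0 := by simpa using ht
  suffices h : ∀ a : ℝ≥0, 0 < a → (a : ℝ≥0∞) < decreasingRearrangement f t →
      ENNReal.ofReal t * a ≤ kFunctional f (ENNReal.ofReal t) by
    rw [mul_comm, ← ENNReal.le_div_iff_mul_le (Or.inl ht0) (Or.inl (by simp))]
    refine le_of_forall_lt fun c hc => ?_
    obtain ⟨a, hca, ha⟩ := ENNReal.lt_iff_exists_nnreal_btwn.1 hc
    have ha0 : 0 < a := by
      have := (zero_le (a := c)).trans_lt hca
      exact_mod_cast this
    refine hca.trans_le ?_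
    rw [ENNReal.le_div_iff_mul_le (Or.inl ht0) (Or.inl (by simp)), mul_comm]
    exact h a ha0 ha
  intro a ha0 ha
  have hS : NullMeasurableSet {x | a < ‖f x‖₊} volume :=
    nullMeasurableSet_lt aemeasurable_const hf.nnnorm.aemeasurable
  obtain ⟨S, hSsub, hSm, hSe⟩ := hS.exists_measurable_subset_ae_eq
  have hlt : ENNReal.ofReal t < volume S := by
    rw [measure_congr hSe]
    exact lt_distributionFn_of_lt ha0 ha
  obtain ⟨T, hTm, hTS, hT1, hT2⟩ := Measure.exists_subset_measure_lt_top hSm hlt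
  have hT0 : volume T ≠ 0 := ((zero_le).trans_lt hT1).ne'
  have hw : ∫⁻ x, T.indicator (fun _ => ENNReal.ofReal t / volume T) x = ENNReal.ofReal t := by
    rw [lintegral_indicator_const hTm, ENNReal.div_mul_cancel hT0 hT2.ne]
  refine le_trans ?_ (le_kFunctional f (w := T.indicator fun _ => ENNReal.ofReal t / volume T)
    (measurable_const.indicator hTm).aemeasurable (fun x => ?_) hw.le)
  · nth_rewrite 1 [← hw]
    rw [← lintegral_mul_const' _ _ (by simp)]
    refine lintegral_mono fun x => ?_
    by_cases hx : x ∈ T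
    · simp only [indicator_of_mem hx]
      gcongr
      exact ENNReal.coe_le_coe.2 (hSsub (hTS hx)).le
    · simp [hx]
  · by_cases hx : x ∈ T
    · simp only [indicator_of_mem hx]
      exact ENNReal.div_le_of_le_mul (by simpa using hT1.le)
    · simp [hx]

lemma lintegral_Ioi_indicator_le (X : ℝ≥0∞) :
    ∫⁻ a in Ioi (0 : ℝ), {a : ℝ | ENNReal.ofReal a ≤ X}.indicator 1 a ≤ X := by
  rcases eq_or_ne X ∞ with rfl | hX
  · exact le_top
  have hm : MeasurableSet {a : ℝ | ENNReal.ofReal a ≤ X} :=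
    measurableSet_le ENNReal.measurable_ofReal measurable_const
  rw [lintegral_indicator_one hm, Measure.restrict_apply hm]
  calc volume ({a : ℝ | ENNReal.ofReal a ≤ X} ∩ Ioi 0) ≤ volume (Ioc 0 X.toReal) :=
        measure_mono fun a ha => ⟨ha.2, (ENNReal.ofReal_le_iff_le_toReal hX).1 ha.1⟩
    _ = X := by simp [hX]

/-- `min(t, d(a)) ≤ |{s ∈ (0, t) : f*(s) ≥ a}|`, where `d` is the distribution function. -/
lemma min_distributionFn_le (t a : ℝ) :
    min (ENNReal.ofReal t) (distributionFn f a.toNNReal) ≤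
      ∫⁻ s in Ioo (0 : ℝ) t,
        {a : ℝ | ENNReal.ofReal a ≤ decreasingRearrangement f s}.indicator 1 a := by
  have hsub : ∀ b : ℝ, b ≤ t → ENNReal.ofReal b ≤ distributionFn f a.toNNReal →
      ENNReal.ofReal b ≤ ∫⁻ s in Ioo (0 : ℝ) t,
        {a : ℝ | ENNReal.ofReal a ≤ decreasingRearrangement f s}.indicator 1 a := by
    intro b hbt hb
    calc ENNReal.ofReal b = ∫⁻ s in Ioo (0 : ℝ) b, 1 := by simp
      _ ≤ ∫⁻ s in Ioo (0 : ℝ) b,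
          {a : ℝ | ENNReal.ofReal a ≤ decreasingRearrangement f s}.indicator 1 a := by
          refine setLIntegral_mono' measurableSet_Ioo fun s hs => ?_
          rw [indicator_of_mem]
          · simp
          · exact le_decreasingRearrangement_of_lt
              (((ENNReal.ofReal_lt_ofReal_iff (hs.1.trans hs.2)).2 hs.2).trans_le hb)
      _ ≤ _ := lintegral_mono_set (Ioo_subset_Ioo_right hbt)
  rcases le_total (ENNReal.ofReal t) (distributionFn f a.toNNReal) with h | h
  · rw [min_eq_left h]
    exact hsub t le_rfl h
  · rw [min_eq_right h]
    have hne : distributionFn f a.toNNReal ≠ ∞ := (h.trans_lt ENNReal.ofReal_lt_top).ne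
    rcases le_or_gt 0 t with ht | ht
    · have := hsub (distributionFn f a.toNNReal).toReal
        (ENNReal.toReal_le_of_le_ofReal ht h) (ENNReal.ofReal_toReal hne).le
      rwa [ENNReal.ofReal_toReal hne] at this
    · rw [ENNReal.ofReal_of_nonpos ht.le] at h
      exact h.trans zero_le

/-- The upper bound of the K-functional, by the layer cake formula for the measure `w dx`, which
gives `{|f| > a}` a mass of at most `min(t, d(a))`. -/
lemma kFunctional_le_lintegral (hf : AEStronglyMeasurable f) (t : ℝ) :
    kFunctional f (ENNReal.ofReal t) ≤ ∫⁻ s in Ioo (0 : ℝ) t, decreasingRearrangement f s := by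
  refine kFunctional_le fun w hw h1 hτ => ?_
  have hac := withDensity_absolutelyContinuous (volume : Measure (EuclideanSpace ℝ (Fin n))) w
  calc ∫⁻ x, w x * ‖f x‖ₑ = ∫⁻ x, ENNReal.ofReal ‖f x‖ ∂(volume.withDensity w) := by
        rw [lintegral_withDensity_eq_lintegral_mul₀ hw hf.norm.aemeasurable.ennreal_ofReal]
        simp
    _ = ∫⁻ a in Ioi (0 : ℝ), (volume.withDensity w) {x | a < ‖f x‖} :=
        lintegral_eq_lintegral_meas_lt _ (ae_of_all _ fun x => norm_nonneg _)
          (hf.norm.aemeasurable.mono_ac hac)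
    _ ≤ ∫⁻ a in Ioi (0 : ℝ), ∫⁻ s in Ioo (0 : ℝ) t,
          {a : ℝ | ENNReal.ofReal a ≤ decreasingRearrangement f s}.indicator 1 a := by
        refine setLIntegral_mono' measurableSet_Ioi fun a ha => ?_
        refine le_trans (le_min ?_ ?_) (min_distributionFn_le t a)
        · calc _ ≤ (volume.withDensity w) univ := measure_mono (subset_univ _)
            _ ≤ _ := by rwa [withDensity_apply _ MeasurableSet.univ, Measure.restrict_univ]
        · have hS : NullMeasurableSet {x | a < ‖f x‖} volume :=
            nullMeasurableSet_lt aemeasurable_const hf.norm.aemeasurable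
          rw [withDensity_apply₀ _ hS]
          calc _ ≤ ∫⁻ x in {x | a < ‖f x‖}, 1 := lintegral_mono h1
            _ = volume {x | a < ‖f x‖} := by simp
            _ ≤ _ := measure_mono fun x hx => by
              simp only [mem_ofPred_eq] at hx ⊢
              rwa [← NNReal.coe_lt_coe, Real.coe_toNNReal a (le_of_lt ha)]
    _ = ∫⁻ s in Ioo (0 : ℝ) t, ∫⁻ a in Ioi (0 : ℝ),
          {a : ℝ | ENNReal.ofReal a ≤ decreasingRearrangement f s}.indicator 1 a := by
        rw [lintegral_lintegral_swap]
        have hm : MeasurableSet {z : ℝ × ℝ | ENNReal.ofReal z.1 ≤ decreasingRearrangement f z.2} :=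
          measurableSet_le (ENNReal.measurable_ofReal.comp measurable_fst)
            ((decreasingRearrangement_measurable f).comp measurable_snd)
        exact (measurable_one.indicator hm).aemeasurable
    _ ≤ _ := lintegral_mono fun s => lintegral_Ioi_indicator_le _

lemma lintegral_Ioo_eq_average {F : ℝ → ℝ≥0∞} (hF : Measurable F) {t : ℝ} (ht : 0 < t) :
    ∫⁻ s in Ioo (0 : ℝ) t, F s = ENNReal.ofReal t * ∫⁻ l in Ioo (0 : ℝ) 1, F (l * t) := by
  rw [← lintegral_indicator measurableSet_Ioo, ← lintegral_indicator measurableSet_Ioo,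
    ← lintegral_comp_mul_left _ (hF.indicator measurableSet_Ioo) ht]
  congr 1
  refine lintegral_congr fun l => ?_
  have : t * l ∈ Ioo 0 t ↔ l ∈ Ioo (0 : ℝ) 1 := by
    simp only [mem_Ioo, mul_pos_iff_of_pos_left ht, mul_lt_iff_lt_one_right ht]
  by_cases hl : l ∈ Ioo (0 : ℝ) 1
  · rw [indicator_of_mem (this.2 hl), indicator_of_mem hl, mul_comm]
  · rw [indicator_of_notMem (fun h => hl (this.1 h)), indicator_of_notMem hl]

lemma kFunctional_le_average (hf : AEStronglyMeasurable f) {t : ℝ} (ht : 0 < t) :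
    kFunctional f (ENNReal.ofReal t) ≤
      ENNReal.ofReal t * ∫⁻ l in Ioo (0 : ℝ) 1, decreasingRearrangement f (l * t) :=
  (kFunctional_le_lintegral hf t).trans_eq
    (lintegral_Ioo_eq_average (decreasingRearrangement_measurable f) ht)

lemma average_measurable (f : EuclideanSpace ℝ (Fin n) → ℂ) :
    Measurable fun t => ∫⁻ l in Ioo (0 : ℝ) 1, decreasingRearrangement f (l * t) :=
  Measurable.lintegral_prod_right' (f := fun z : ℝ × ℝ => decreasingRearrangement f (z.2 * z.1))
    ((decreasingRearrangement_measurable f).comp (measurable_snd.mul measurable_fst))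

lemma toReal_inv_lt_one {q : ℝ≥0∞} (hq : 1 < q) : (q⁻¹).toReal < 1 := by
  have : q⁻¹ < 1 := ENNReal.inv_lt_one.2 hq
  simpa using ENNReal.toReal_strict_mono ENNReal.one_ne_top this

/-- Functions in `L^{q,q₁}`, `q > 1`, lie in `L¹ + L^∞`. By Hardy's inequality the average of `f*` is
finite at arbitrarily large `t`, and the K-functional is monotone. -/
lemma MemLorentz.kFunctional_lt_top {q q₁ : ℝ≥0∞} (hq : 1 < q) (hq₁ : 1 ≤ q₁)
    (hf : MemLorentz f q q₁) {τ : ℝ≥0∞} (hτ : τ ≠ ∞) : kFunctional f τ < ∞ := by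
  have hH := haarNorm_average_le (decreasingRearrangement_measurable f) hq₁
    (toReal_inv_lt_one hq)
  have hfin := hH.trans_lt (ENNReal.mul_lt_top
    (lintegral_rpow_neg_lt_top (toReal_inv_lt_one hq)) hf.2)
  set U := fun t => ∫⁻ l in Ioo (0 : ℝ) 1, decreasingRearrangement f (l * t) with hU
  suffices h : ∃ t : ℝ, τ.toReal < t ∧ ENNReal.ofReal t ^ (q⁻¹).toReal * U t < ∞ by
    obtain ⟨t, hτt, hlt⟩ := h
    have ht : 0 < t := ENNReal.toReal_nonneg.trans_lt hτt
    have hUt : U t < ∞ := by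
      rw [lt_top_iff_ne_top]
      intro h
      rw [h, ENNReal.mul_top] at hlt
      · exact hlt.false
      · exact (ENNReal.rpow_pos (by simpa using ht) (by simp)).ne'
    calc kFunctional f τ ≤ kFunctional f (ENNReal.ofReal t) :=
          kFunctional_mono f ((ENNReal.le_ofReal_iff_toReal_le hτ ht.le).2 hτt.le)
      _ ≤ _ := kFunctional_le_average hf.1 ht
      _ < ∞ := ENNReal.mul_lt_top ENNReal.ofReal_lt_top hUt
  unfold haarNorm at hfin
  split_ifs at hfin with h
  · refine ⟨τ.toReal + 1, by linarith, lt_of_le_of_lt ?_ hfin⟩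
    have h0 : 0 < τ.toReal + 1 := by positivity
    exact le_iSup₂ (f := fun t (_ : 0 < t) => ENNReal.ofReal t ^ (q⁻¹).toReal * U t) _ h0
  · have hq0 : 0 < q₁.toReal := ENNReal.toReal_pos (by positivity) h
    have hI : ∫⁻ t in Ioi (0 : ℝ), (ENNReal.ofReal t ^ (q⁻¹).toReal * U t) ^ q₁.toReal /
        ENNReal.ofReal t ≠ ∞ := by
      intro hI
      rw [hI, ENNReal.toReal_inv, ENNReal.top_rpow_of_pos (by positivity)] at hfin
      exact hfin.false
    have hI' : ∫⁻ t in Ioi τ.toReal, (ENNReal.ofReal t ^ (q⁻¹).toReal * U t) ^ q₁.toReal /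
        ENNReal.ofReal t ≠ ∞ :=
      ((lintegral_mono_set (Ioi_subset_Ioi ENNReal.toReal_nonneg)).trans_lt hI.lt_top).ne
    have hm : Measurable fun t => (ENNReal.ofReal t ^ (q⁻¹).toReal * U t) ^ q₁.toReal /
        ENNReal.ofReal t :=
      (((ENNReal.measurable_ofReal.pow_const _).mul (average_measurable f)).pow_const _).div
        ENNReal.measurable_ofReal
    have hae := ae_lt_top hm hI'
    have : (ae (volume.restrict (Ioi τ.toReal))).NeBot := by
      rw [ae_neBot]
      simp
    obtain ⟨t, ht1, ht2⟩ := (hae.and (ae_restrict_mem measurableSet_Ioi)).exists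
    refine ⟨t, ht2, ?_⟩
    rw [lt_top_iff_ne_top]
    intro h
    rw [h, ENNReal.top_rpow_of_pos hq0, ENNReal.top_div_of_ne_top (by simp)] at ht1
    exact ht1.false

/-- An interpolation inequality between K-functionals, valid at every `t`, implies the
corresponding inequality between Lorentz norms. -/
lemma exists_lorentzNorm_le_of_kFunctional_le {q r q₁ r₁ p p₁ : ℝ≥0∞}
    (hq : 1 < q) (hr : 1 < r) (hq₁ : 1 ≤ q₁) (hr₁ : 1 ≤ r₁) {θ : ℝ} (h0 : 0 < θ) (h1 : θ < 1)
    (hp : p⁻¹ = ENNReal.ofReal (1 - θ) * q⁻¹ + ENNReal.ofReal θ * r⁻¹)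
    (hp₁ : p₁⁻¹ = ENNReal.ofReal (1 - θ) * q₁⁻¹ + ENNReal.ofReal θ * r₁⁻¹) {c : ℝ≥0∞}
    (hc : c ≠ ∞) :
    ∃ C : ℝ≥0∞, C ≠ ∞ ∧ ∀ u g h : EuclideanSpace ℝ (Fin n) → ℂ,
      AEStronglyMeasurable u → AEStronglyMeasurable g → AEStronglyMeasurable h →
      (∀ t : ℝ, 0 < t → kFunctional h (ENNReal.ofReal t) ≤
        c * (kFunctional u (ENNReal.ofReal t) ^ (1 - θ) *
          kFunctional g (ENNReal.ofReal t) ^ θ)) →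
      lorentzNorm h p p₁ ≤ C * (lorentzNorm u q q₁ ^ (1 - θ) * lorentzNorm g r r₁ ^ θ) := by
  have h1' : 0 < 1 - θ := by linarith
  set A := ∫⁻ l in Ioo (0 : ℝ) 1, ENNReal.ofReal l ^ (-(q⁻¹).toReal) with hA
  set B := ∫⁻ l in Ioo (0 : ℝ) 1, ENNReal.ofReal l ^ (-(r⁻¹).toReal) with hB
  have hAt : A ≠ ∞ := (lintegral_rpow_neg_lt_top (toReal_inv_lt_one hq)).ne
  have hBt : B ≠ ∞ := (lintegral_rpow_neg_lt_top (toReal_inv_lt_one hr)).ne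
  refine ⟨c * (A ^ (1 - θ) * B ^ θ), ENNReal.mul_ne_top hc (ENNReal.mul_ne_top
    (ENNReal.rpow_ne_top_of_nonneg h1'.le hAt) (ENNReal.rpow_ne_top_of_nonneg h0.le hBt)),
    fun u g h hu hg hh hK => ?_⟩
  have hq' : q⁻¹ ≠ ∞ := by simp; positivity
  have hr' : r⁻¹ ≠ ∞ := by simp; positivity
  have hpR : (p⁻¹).toReal = (q⁻¹).toReal * (1 - θ) + (r⁻¹).toReal * θ := by
    rw [hp, ENNReal.toReal_add (ENNReal.mul_ne_top (by simp) hq')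
      (ENNReal.mul_ne_top (by simp) hr'), ENNReal.toReal_mul, ENNReal.toReal_mul,
      ENNReal.toReal_ofReal h1'.le, ENNReal.toReal_ofReal h0.le]
    ring
  have hp1 : 1 ≤ p₁ := by
    rw [← ENNReal.inv_le_one, hp₁]
    calc _ ≤ ENNReal.ofReal (1 - θ) * 1 + ENNReal.ofReal θ * 1 := by
          gcongr <;> simpa using by assumption
      _ = 1 := by
          rw [mul_one, mul_one, ← ENNReal.ofReal_add h1'.le h0.le]
          simp
  set U := fun t => ∫⁻ l in Ioo (0 : ℝ) 1, decreasingRearrangement u (l * t) with hU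
  set G := fun t => ∫⁻ l in Ioo (0 : ℝ) 1, decreasingRearrangement g (l * t) with hG
  have hpt : ∀ t : ℝ, 0 < t → ENNReal.ofReal t ^ (p⁻¹).toReal * decreasingRearrangement h t ≤
      c * ((ENNReal.ofReal t ^ (q⁻¹).toReal * U t) ^ (1 - θ) *
        (ENNReal.ofReal t ^ (r⁻¹).toReal * G t) ^ θ) := by
    intro t ht
    have ht0 : ENNReal.ofReal t ≠ 0 := by simpa using ht
    have e : decreasingRearrangement h t ≤ c * (U t ^ (1 - θ) * G t ^ θ) := by
      rw [← ENNReal.mul_le_mul_iff_right ht0 (by simp)]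
      calc _ ≤ _ := mul_decreasingRearrangement_le_kFunctional hh ht
        _ ≤ _ := hK t ht
        _ ≤ c * ((ENNReal.ofReal t * U t) ^ (1 - θ) * (ENNReal.ofReal t * G t) ^ θ) := by
          gcongr
          · exact kFunctional_le_average hu ht
          · exact kFunctional_le_average hg ht
        _ = c * ((ENNReal.ofReal t ^ (1 - θ) * ENNReal.ofReal t ^ θ) *
            (U t ^ (1 - θ) * G t ^ θ)) := by
          rw [ENNReal.mul_rpow_of_nonneg _ _ h1'.le, ENNReal.mul_rpow_of_nonneg _ _ h0.le]
          ring
        _ = _ := by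
          rw [← ENNReal.rpow_add_of_nonneg _ _ h1'.le h0.le, sub_add_cancel, ENNReal.rpow_one]
          ring
    calc _ ≤ ENNReal.ofReal t ^ (p⁻¹).toReal * (c * (U t ^ (1 - θ) * G t ^ θ)) := by gcongr
      _ = _ := by
        rw [ENNReal.mul_rpow_of_nonneg _ _ h1'.le, ENNReal.mul_rpow_of_nonneg _ _ h0.le, hpR,
          ENNReal.rpow_add _ _ ht0 (by simp), ← ENNReal.rpow_mul, ← ENNReal.rpow_mul]
        ring
  have hm := ENNReal.measurable_ofReal
  rw [lorentzNorm_eq_haarNorm]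
  calc _ ≤ _ := haarNorm_mono p₁ hpt
    _ = c * haarNorm (fun t => (ENNReal.ofReal t ^ (q⁻¹).toReal * U t) ^ (1 - θ) *
        (ENNReal.ofReal t ^ (r⁻¹).toReal * G t) ^ θ) p₁ := haarNorm_const_mul hp1 hc
    _ ≤ c * (haarNorm (fun t => ENNReal.ofReal t ^ (q⁻¹).toReal * U t) q₁ ^ (1 - θ) *
        haarNorm (fun t => ENNReal.ofReal t ^ (r⁻¹).toReal * G t) r₁ ^ θ) := by
        gcongr
        exact haarNorm_mul_rpow_le ((hm.pow_const _).mul (average_measurable u))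
          ((hm.pow_const _).mul (average_measurable g)) hq₁ hr₁ h0 h1 hp₁
    _ ≤ c * ((A * lorentzNorm u q q₁) ^ (1 - θ) * (B * lorentzNorm g r r₁) ^ θ) := by
        gcongr
        · exact haarNorm_average_le (decreasingRearrangement_measurable u) hq₁
            (toReal_inv_lt_one hq)
        · exact haarNorm_average_le (decreasingRearrangement_measurable g) hr₁
            (toReal_inv_lt_one hr)
    _ = _ := by
        rw [ENNReal.mul_rpow_of_nonneg _ _ h1'.le, ENNReal.mul_rpow_of_nonneg _ _ h0.le]
        ring

end KFunctional

/-! ### Dilations and dilation averages of integrable kernels -/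

section Fourier

variable {n : ℕ}

/-- The `L¹`-normalised dilation `x ↦ A^{-n} K (x / A)`, with Fourier transform `𝓕 K (A ξ)`. -/
noncomputable def dilate (A : ℝ) (K : EuclideanSpace ℝ (Fin n) → ℂ) :
    EuclideanSpace ℝ (Fin n) → ℂ :=
  fun x => ((A ^ n)⁻¹ : ℝ) • K (A⁻¹ • x)

lemma dilate_integrable {A : ℝ} (hA : 0 < A) {K : EuclideanSpace ℝ (Fin n) → ℂ}
    (hK : Integrable K) : Integrable (dilate A K) :=
  (hK.comp_smul (inv_ne_zero hA.ne')).smul ((A ^ n)⁻¹ : ℝ)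

lemma integral_norm_dilate {A : ℝ} (hA : 0 < A) (K : EuclideanSpace ℝ (Fin n) → ℂ) :
    ∫ x, ‖dilate A K x‖ = ∫ x, ‖K x‖ := by
  simp only [dilate, norm_smul, integral_const_mul]
  rw [Measure.integral_comp_inv_smul_of_nonneg volume (fun x => ‖K x‖) hA.le]
  have : A ^ n ≠ 0 := by positivity
  rw [finrank_euclideanSpace_fin, smul_eq_mul, ← mul_assoc, Real.norm_of_nonneg (by positivity),
    inv_mul_cancel₀ this, one_mul]

lemma fourier_dilate {A : ℝ} (hA : 0 < A) (K : EuclideanSpace ℝ (Fin n) → ℂ)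
    (ξ : EuclideanSpace ℝ (Fin n)) : 𝓕 (dilate A K) ξ = 𝓕 K (A • ξ) := by
  have hn : A ^ n ≠ 0 := by positivity
  rw [Real.fourier_eq, Real.fourier_eq]
  have : ∀ x : EuclideanSpace ℝ (Fin n), Real.fourierChar (-inner ℝ x ξ) • dilate A K x
      = ((A ^ n)⁻¹ : ℝ) • (fun y => Real.fourierChar (-inner ℝ y (A • ξ)) • K y) (A⁻¹ • x) := by
    intro x
    simp only [dilate, inner_smul_left, inner_smul_right]
    rw [smul_comm]
    congr 4
    simp
    field_simp
  rw [integral_congr_ae (ae_of_all _ this), integral_smul,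
    Measure.integral_comp_inv_smul_of_nonneg volume
      (fun y => Real.fourierChar (-inner ℝ y (A • ξ)) • K y) hA.le, finrank_euclideanSpace_fin, smul_smul, inv_mul_cancel₀ hn, one_smul]

/-- An integrable superposition of dilates of a Schwartz function is the Fourier transform of an
integrable function, namely of the superposition of the (dilated) inverse Fourier transforms. -/
lemma exists_fourier_eq_integral_dilates (φ : 𝓢(EuclideanSpace ℝ (Fin n), ℂ)) {S : Set ℝ}
    (hS : MeasurableSet S) (hS0 : S ⊆ Ioi 0) {w : ℝ → ℝ} (hwm : Measurable w)
    (hw : IntegrableOn w S) :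
    ∃ K : EuclideanSpace ℝ (Fin n) → ℂ, Integrable K ∧
      ∀ ξ, 𝓕 K ξ = ∫ t in S, (w t : ℂ) * φ (t • ξ) := by
  set ψ : 𝓢(EuclideanSpace ℝ (Fin n), ℂ) := 𝓕⁻ φ with hψ
  have hφ : ∀ ξ, 𝓕 (ψ : EuclideanSpace ℝ (Fin n) → ℂ) ξ = φ ξ := fun ξ => by
    rw [← SchwartzMap.fourier_coe, hψ, FourierTransform.fourier_fourierInv_eq]
  set κ : ℝ → EuclideanSpace ℝ (Fin n) → ℂ := fun t x => (w t : ℂ) * dilate t ψ x with hκ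
  have hm : Measurable (fun z : ℝ × EuclideanSpace ℝ (Fin n) => κ z.1 z.2) := by
    have : Measurable (ψ : EuclideanSpace ℝ (Fin n) → ℂ) := ψ.continuous.measurable
    simp only [hκ, dilate]
    fun_prop
  have hint : Integrable (fun z : ℝ × EuclideanSpace ℝ (Fin n) => κ z.1 z.2)
      ((volume.restrict S).prod volume) := by
    rw [integrable_prod_iff hm.aestronglyMeasurable]
    constructor
    · filter_upwards [ae_restrict_mem hS] with t ht
      exact (dilate_integrable (hS0 ht) ψ.integrable).const_mul _
    · refine (hw.norm.mul_const (∫ x, ‖ψ x‖)).congr ?_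
      filter_upwards [ae_restrict_mem hS] with t ht
      simp only [hκ, norm_mul, integral_const_mul, integral_norm_dilate (hS0 ht)]
      simp
  refine ⟨fun x => ∫ t in S, κ t x, hint.integral_prod_right, fun ξ => ?_⟩
  rw [Real.fourier_eq]
  calc ∫ x, Real.fourierChar (-inner ℝ x ξ) • ∫ t in S, κ t x
      = ∫ x, ∫ t in S, Real.fourierChar (-inner ℝ x ξ) • κ t x := by
        simp_rw [Circle.smul_def, integral_smul]
    _ = ∫ t in S, ∫ x, Real.fourierChar (-inner ℝ x ξ) • κ t x := by
        refine (integral_integral_swap ?_).symm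
        refine hint.mono ?_ (ae_of_all _ fun z => by simp [Function.uncurry])
        have : Continuous fun z : ℝ × EuclideanSpace ℝ (Fin n) =>
            Real.fourierChar (-inner ℝ z.2 ξ) :=
          Real.continuous_fourierChar.comp (by fun_prop)
        exact this.aestronglyMeasurable.smul hm.aestronglyMeasurable
    _ = ∫ t in S, (w t : ℂ) * φ (t • ξ) := by
        refine setIntegral_congr_fun hS fun t ht => ?_
        rw [← hφ, ← fourier_dilate (hS0 ht), Real.fourier_eq, ← integral_const_mul]
        refine integral_congr_ae (ae_of_all _ fun x => ?_)
        simp only [hκ, Circle.smul_def, smul_eq_mul]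
        ring

/-! ### Splitting of the symbol of the fractional Laplacian -/

/-- A smooth bump on the line, supported in `[1, 3]`. -/
noncomputable def annulusBump : ContDiffBump (2 : ℝ) := ⟨1 / 2, 1, by norm_num, by norm_num⟩

lemma annulusBump_eq_zero {x : ℝ} (hx : x ≤ 1) : annulusBump x = 0 := by
  apply annulusBump.zero_of_le_dist
  rw [Real.dist_eq, abs_of_nonpos (by linarith)]
  simp only [annulusBump]
  linarith

lemma annulusBump_eq_zero' {x : ℝ} (hx : 3 ≤ x) : annulusBump x = 0 := by
  apply annulusBump.zero_of_le_dist
  rw [Real.dist_eq, abs_of_nonneg (by linarith)]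
  simp only [annulusBump]
  linarith

/-- Powers of `‖ξ‖` times a bump that vanishes near the origin are Schwartz functions. -/
lemma exists_schwartz_annulus (s : ℝ) : ∃ φ : 𝓢(EuclideanSpace ℝ (Fin n), ℂ),
    ∀ ξ, φ ξ = ((‖ξ‖ ^ s * annulusBump ‖ξ‖ : ℝ) : ℂ) := by
  have hsmooth : ContDiff ℝ (⊤ : ℕ∞) fun ξ : EuclideanSpace ℝ (Fin n) =>
      ((‖ξ‖ ^ s * annulusBump ‖ξ‖ : ℝ) : ℂ) := by
    refine Complex.ofRealCLM.contDiff.comp ?_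
    rw [contDiff_iff_contDiffAt]
    intro ξ
    by_cases hξ : ξ = 0
    · subst hξ
      have : (fun ξ : EuclideanSpace ℝ (Fin n) => ‖ξ‖ ^ s * annulusBump ‖ξ‖)
          =ᶠ[nhds 0] fun _ => 0 := by
        filter_upwards [Metric.ball_mem_nhds (0 : EuclideanSpace ℝ (Fin n)) one_pos] with x hx
        rw [annulusBump_eq_zero (by simpa using (mem_ball_zero_iff.1 hx).le), mul_zero]
      exact contDiffAt_const.congr_of_eventuallyEq this
    · have hn : ContDiffAt ℝ (⊤ : ℕ∞) (fun ξ : EuclideanSpace ℝ (Fin n) => ‖ξ‖) ξ :=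
        contDiffAt_norm ℝ hξ
      exact (hn.rpow_const_of_ne (norm_ne_zero_iff.2 hξ)).mul
        (annulusBump.contDiff.contDiffAt.comp ξ hn)
  have hsupp : HasCompactSupport fun ξ : EuclideanSpace ℝ (Fin n) =>
      ((‖ξ‖ ^ s * annulusBump ‖ξ‖ : ℝ) : ℂ) := by
    refine HasCompactSupport.intro (isCompact_closedBall (0 : EuclideanSpace ℝ (Fin n)) 3) ?_
    intro x hx
    rw [annulusBump_eq_zero' (by simpa using (not_le.1 (fun h => hx (by simpa using h))).le)]
    simp
  exact ⟨hsupp.toSchwartzMap hsmooth, fun ξ => rfl⟩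

lemma integrableOn_rpow_mul_annulusBump (b : ℝ) :
    IntegrableOn (fun t : ℝ => t ^ b * annulusBump t) (Ioi 0) := by
  have h1 : IntegrableOn (fun t : ℝ => t ^ b * annulusBump t) (Icc 1 3) := by
    refine ContinuousOn.integrableOn_Icc ?_
    refine ContinuousOn.mul (fun t ht => ?_) annulusBump.continuous.continuousOn
    exact (Real.continuousAt_rpow_const _ _ (Or.inl (by linarith [ht.1]))).continuousWithinAt
  refine h1.of_forall_sdiff_eq_zero measurableSet_Ioi fun t ht => ?_
  by_cases h : t ≤ 1
  · rw [annulusBump_eq_zero h, mul_zero]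
  · rw [annulusBump_eq_zero', mul_zero]
    by_contra! h3
    exact ht.2 ⟨by linarith, h3.le⟩

lemma integral_rpow_mul_annulusBump_pos (b : ℝ) :
    0 < ∫ t in Ioi (0 : ℝ), t ^ b * annulusBump t := by
  rw [setIntegral_pos_iff_support_of_nonneg_ae _ (integrableOn_rpow_mul_annulusBump b)]
  · have : Ioo (1 : ℝ) 3 ⊆ (Function.support fun t : ℝ => t ^ b * annulusBump t) ∩ Ioi 0 := by
      intro t ht
      have ht0 : 0 < t := by linarith [ht.1]
      refine ⟨(mul_pos (Real.rpow_pos_of_pos ht0 _) (annulusBump.pos_of_mem_ball ?_)).ne', ht0⟩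
      rw [Metric.mem_ball, Real.dist_eq, abs_lt]
      simp only [annulusBump]
      constructor <;> linarith [ht.1, ht.2]
    refine lt_of_lt_of_le ?_ (measure_mono this)
    simp only [Real.volume_Ioo, ENNReal.ofReal_pos]
    norm_num
  · filter_upwards [ae_restrict_mem measurableSet_Ioi] with t ht
    exact mul_nonneg (Real.rpow_nonneg (le_of_lt ht) _) annulusBump.nonneg

/-- `‖ξ‖^σ` splits into a multiplier with integrable kernel and `‖ξ‖^s` times another one. Both come
from the identity `c ‖ξ‖^{σ-s} = ∫₀^∞ t^{s-σ-1} χ(t‖ξ‖) dt`, with `χ` supported in an annulus: the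
part `t ≤ 1` is `𝓕 L`, and the part `t > 1`, multiplied by `‖ξ‖^s`, is `𝓕 K`. -/
lemma exists_fourier_splitting {σ s : ℝ} (hσ : 0 < σ) (hσs : σ < s) :
    ∃ K L : EuclideanSpace ℝ (Fin n) → ℂ, Integrable K ∧ Integrable L ∧
      ∀ ξ, ((‖ξ‖ ^ σ : ℝ) : ℂ) = 𝓕 K ξ + ((‖ξ‖ ^ s : ℝ) : ℂ) * 𝓕 L ξ := by
  set b := s - σ - 1 with hb
  set c := ∫ t in Ioi (0 : ℝ), t ^ b * annulusBump t with hc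
  have hc0 : 0 < c := integral_rpow_mul_annulusBump_pos b
  obtain ⟨φ₀, hφ₀⟩ := exists_schwartz_annulus (n := n) 0
  obtain ⟨φ, hφ⟩ := exists_schwartz_annulus (n := n) s
  obtain ⟨L, hL, hLξ⟩ := exists_fourier_eq_integral_dilates φ₀ (S := Ioc 0 1) measurableSet_Ioc
    (fun t ht => ht.1) (w := fun t => c⁻¹ * t ^ b) (by fun_prop)
    (((integrableOn_Ioc_iff_integrableOn_Ioo (by simp)).2
      ((intervalIntegral.integrableOn_Ioo_rpow_iff one_pos).2 (by linarith))).const_mul _)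
  obtain ⟨K, hK, hKξ⟩ := exists_fourier_eq_integral_dilates φ (S := Ioi 1) measurableSet_Ioi
    (fun t ht => lt_trans one_pos (mem_Ioi.1 ht)) (w := fun t => c⁻¹ * t ^ (-σ - 1)) (by fun_prop)
    ((integrableOn_Ioi_rpow_of_lt (by linarith) one_pos).const_mul _)
  refine ⟨K, L, hK, hL, fun ξ => ?_⟩
  rcases eq_or_ne ξ 0 with rfl | hξ
  · rw [hKξ, hLξ]
    simp [hφ, annulusBump_eq_zero zero_le_one, hσ.ne', (hσ.trans hσs).ne']
  have hr : 0 < ‖ξ‖ := norm_pos_iff.2 hξ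
  set r := ‖ξ‖ with hrdef
  have hLr : 𝓕 L ξ = ((c⁻¹ * ∫ t in Ioc (0 : ℝ) 1, t ^ b * annulusBump (r * t) : ℝ) : ℂ) := by
    rw [hLξ, ← integral_const_mul, ← integral_complex_ofReal]
    refine setIntegral_congr_fun measurableSet_Ioc fun t ht => ?_
    simp only [hφ₀, norm_smul, Real.norm_of_nonneg ht.1.le, ← hrdef, Real.rpow_zero, one_mul]
    push_cast
    rw [mul_comm r t]
    ring
  have hKr : 𝓕 K ξ
      = ((r ^ s * (c⁻¹ * ∫ t in Ioi (1 : ℝ), t ^ b * annulusBump (r * t)) : ℝ) : ℂ) := by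
    rw [hKξ, ← integral_const_mul, ← integral_const_mul, ← integral_complex_ofReal]
    refine setIntegral_congr_fun measurableSet_Ioi fun t ht => ?_
    have ht0 : 0 < t := lt_trans one_pos ht
    simp only [hφ, norm_smul, Real.norm_of_nonneg ht0.le, ← hrdef]
    have e : t ^ b = t ^ (-σ - 1) * t ^ s := by
      rw [← Real.rpow_add ht0, hb]; congr 1; ring
    rw [Real.mul_rpow ht0.le hr.le, e, mul_comm r t]
    push_cast
    ring
  have hscale : ∫ t in Ioi (0 : ℝ), t ^ b * annulusBump (r * t) = r ^ (σ - s) * c := by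
    have h1 := integral_comp_mul_left_Ioi (fun t : ℝ => t ^ b * annulusBump t) 0 hr
    rw [mul_zero, smul_eq_mul, ← hc] at h1
    have h2 : ∫ t in Ioi (0 : ℝ), (r * t) ^ b * annulusBump (r * t)
        = r ^ b * ∫ t in Ioi (0 : ℝ), t ^ b * annulusBump (r * t) := by
      rw [← integral_const_mul]
      refine setIntegral_congr_fun measurableSet_Ioi fun t ht => ?_
      simp only [Real.mul_rpow hr.le (le_of_lt ht), mul_assoc]
    rw [h2] at h1
    have e : r ^ (σ - s) = r⁻¹ * (r ^ b)⁻¹ := by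
      rw [← Real.rpow_neg hr.le, ← Real.rpow_neg_one, ← Real.rpow_add hr, hb]; congr 1; ring
    rw [e, mul_right_comm, ← h1]
    have : r ^ b ≠ 0 := (Real.rpow_pos_of_pos hr _).ne'
    field_simp
  have hint : IntegrableOn (fun t : ℝ => t ^ b * annulusBump (r * t)) (Ioi 0) := by
    have h1 : IntegrableOn (fun t : ℝ => (r * t) ^ b * annulusBump (r * t)) (Ioi 0) := by
      have := (integrableOn_Ioi_comp_mul_left_iff (fun t : ℝ => t ^ b * annulusBump t) 0 hr).2
        (by simpa using integrableOn_rpow_mul_annulusBump b)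
      simpa using this
    have h2 : IntegrableOn (fun t : ℝ => (r ^ b)⁻¹ * ((r * t) ^ b * annulusBump (r * t))) (Ioi 0) :=
      h1.const_mul _
    refine h2.congr_fun (fun t ht => ?_) measurableSet_Ioi
    have : r ^ b ≠ 0 := (Real.rpow_pos_of_pos hr _).ne'
    simp only [Real.mul_rpow hr.le (le_of_lt ht)]
    field_simp
  have hsplit := setIntegral_union (Ioc_disjoint_Ioi le_rfl) measurableSet_Ioi
    (hint.mono_set (s := Ioc 0 1) fun t ht => ht.1)
    (hint.mono_set (Ioi_subset_Ioi zero_le_one))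
  rw [Ioc_union_Ioi_eq_Ioi zero_le_one, hscale] at hsplit
  rw [hLr, hKr]
  norm_cast
  calc r ^ σ = r ^ s * (c⁻¹ * (r ^ (σ - s) * c)) := by
        rw [mul_comm _ c, inv_mul_cancel_left₀ hc0.ne', ← Real.rpow_add hr]; congr 1; ring
    _ = _ := by rw [hsplit]; ring

/-- The splitting of the symbol at an arbitrary scale `A`, obtained by dilation, in the
normalisation of Mathlib's Fourier transform. The `L¹` norms of the kernels do not depend on `A`. -/
lemma exists_fourier_splitting_scale {σ s : ℝ} (hσ : 0 < σ) (hσs : σ < s) :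
    ∃ K L : EuclideanSpace ℝ (Fin n) → ℂ, Integrable K ∧ Integrable L ∧ ∀ A : ℝ, 0 < A → ∀ ξ,
      (((2 * Real.pi * ‖ξ‖) ^ σ : ℝ) : ℂ) = ((A ^ (-σ) : ℝ) : ℂ) * 𝓕 (dilate A K) ξ +
        ((A ^ (s - σ) : ℝ) : ℂ) * (𝓕 (dilate A L) ξ * (((2 * Real.pi * ‖ξ‖) ^ s : ℝ) : ℂ)) := by
  obtain ⟨K, L, hK, hL, h⟩ := exists_fourier_splitting (n := n) hσ hσs
  have hπ : 0 < 2 * Real.pi := by positivity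
  refine ⟨dilate (2 * Real.pi) K, dilate (2 * Real.pi) L, dilate_integrable hπ hK,
    dilate_integrable hπ hL, fun A hA ξ => ?_⟩
  simp only [fourier_dilate hA, fourier_dilate hπ]
  have h1 := h ((2 * Real.pi) • A • ξ)
  have h2 : ‖(2 * Real.pi) • A • ξ‖ = A * (2 * Real.pi * ‖ξ‖) := by
    rw [norm_smul, norm_smul, Real.norm_of_nonneg hπ.le, Real.norm_of_nonneg hA.le]; ring
  rw [h2, Real.mul_rpow hA.le (by positivity), Real.mul_rpow hA.le (by positivity)] at h1
  have h3 : A ^ (-σ) * A ^ σ = 1 := by rw [← Real.rpow_add hA]; simp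
  have h4 : A ^ (s - σ) = A ^ (-σ) * A ^ s := by rw [← Real.rpow_add hA]; congr 1; ring
  rw [h4]
  calc _ = ((A ^ (-σ) * A ^ σ * (2 * Real.pi * ‖ξ‖) ^ σ : ℝ) : ℂ) := by rw [h3, one_mul]
    _ = ((A ^ (-σ) : ℝ) : ℂ) * ((A ^ σ * (2 * Real.pi * ‖ξ‖) ^ σ : ℝ) : ℂ) := by
      push_cast; ring
    _ = _ := by rw [h1]; push_cast; ring

end Fourier

/-! ### Convolution formulas for the fractional Laplacian of a Schwartz function -/

section Convolution

variable {n : ℕ}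

lemma fourier_continuous {K : EuclideanSpace ℝ (Fin n) → ℂ} (hK : Integrable K) :
    Continuous (𝓕 K) :=
  VectorFourier.fourierIntegral_continuous Real.continuous_fourierChar continuous_inner hK

lemma fourier_mul_integrable {K ψ : EuclideanSpace ℝ (Fin n) → ℂ} (hK : Integrable K)
    (hψ : Integrable ψ) : Integrable fun ξ => 𝓕 K ξ * ψ ξ :=
  hψ.bdd_mul (c := ∫ x, ‖K x‖) (fourier_continuous hK).aestronglyMeasurable
    (ae_of_all _ fun _ => VectorFourier.norm_fourierIntegral_le_integral_norm _ _ _ _ _)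

/-- Multiplication by `𝓕 K` is convolution with `K`, by Fubini's theorem. -/
lemma fourierInv_fourier_mul {K ψ : EuclideanSpace ℝ (Fin n) → ℂ} (hK : Integrable K)
    (hψ : Integrable ψ) (x : EuclideanSpace ℝ (Fin n)) :
    𝓕⁻ (fun ξ => 𝓕 K ξ * ψ ξ) x = ∫ y, K y * 𝓕⁻ ψ (x - y) := by
  have hint : Integrable (fun z : EuclideanSpace ℝ (Fin n) × EuclideanSpace ℝ (Fin n) =>
      Real.fourierChar (inner ℝ z.2 (x - z.1)) • (K z.1 * ψ z.2)) (volume.prod volume) := by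
    have h := hK.mul_prod hψ
    refine h.mono ?_ (ae_of_all _ fun z => by simp)
    have : Continuous fun z : EuclideanSpace ℝ (Fin n) × EuclideanSpace ℝ (Fin n) =>
        Real.fourierChar (inner ℝ z.2 (x - z.1)) :=
      Real.continuous_fourierChar.comp (by fun_prop)
    exact this.aestronglyMeasurable.smul h.1
  rw [Real.fourierInv_eq]
  calc ∫ ξ, Real.fourierChar (inner ℝ ξ x) • (𝓕 K ξ * ψ ξ)
      = ∫ ξ, ∫ y, Real.fourierChar (inner ℝ ξ (x - y)) • (K y * ψ ξ) := by
        refine integral_congr_ae (ae_of_all _ fun ξ => ?_)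
        simp only [Real.fourier_eq, Circle.smul_def, smul_eq_mul]
        rw [← integral_mul_const, ← integral_const_mul]
        refine integral_congr_ae (ae_of_all _ fun y => ?_)
        have : Real.fourierChar (inner ℝ ξ (x - y))
            = Real.fourierChar (inner ℝ ξ x) * Real.fourierChar (-inner ℝ y ξ) := by
          rw [← AddChar.map_add_eq_mul, inner_sub_right, real_inner_comm y ξ, sub_eq_add_neg]
        simp only [this, Circle.coe_mul]
        ring
    _ = ∫ y, ∫ ξ, Real.fourierChar (inner ℝ ξ (x - y)) • (K y * ψ ξ) :=
        (integral_integral_swap hint).symm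
    _ = _ := by
        refine integral_congr_ae (ae_of_all _ fun y => ?_)
        simp only [Real.fourierInv_eq, Circle.smul_def, smul_eq_mul]
        rw [← integral_const_mul]
        refine integral_congr_ae (ae_of_all _ fun ξ => ?_)
        simp only
        ring

lemma fourierInv_linear_combination {f g : EuclideanSpace ℝ (Fin n) → ℂ} (hf : Integrable f)
    (hg : Integrable g) (a b : ℂ) (x : EuclideanSpace ℝ (Fin n)) :
    𝓕⁻ (fun ξ => a * f ξ + b * g ξ) x = a * 𝓕⁻ f x + b * 𝓕⁻ g x := by
  have h : ∀ {f : EuclideanSpace ℝ (Fin n) → ℂ}, Integrable f →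
      Integrable fun ξ => Real.fourierChar (inner ℝ ξ x) • f ξ := by
    intro f hf
    have := (Real.fourierIntegral_convergent_iff (-x)).2 hf
    simpa using this
  simp only [Real.fourierInv_eq]
  rw [← integral_const_mul, ← integral_const_mul,
    ← integral_add ((h hf).const_mul a) ((h hg).const_mul b)]
  refine integral_congr_ae (ae_of_all _ fun ξ => ?_)
  simp only [Circle.smul_def, smul_eq_mul]
  ring

lemma symbol_mul_fourier_integrable {s : ℝ} (hs : 0 ≤ s) (φ : 𝓢(EuclideanSpace ℝ (Fin n), ℂ)) :
    Integrable fun ξ : EuclideanSpace ℝ (Fin n) =>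
      (((2 * Real.pi * ‖ξ‖) ^ s : ℝ) : ℂ) * 𝓕 (φ : EuclideanSpace ℝ (Fin n) → ℂ) ξ := by
  obtain ⟨N, hN⟩ := exists_nat_ge s
  set ψ : 𝓢(EuclideanSpace ℝ (Fin n), ℂ) := 𝓕 φ with hψ
  have hψφ : (ψ : EuclideanSpace ℝ (Fin n) → ℂ) = 𝓕 (φ : EuclideanSpace ℝ (Fin n) → ℂ) := by
    rw [hψ, SchwartzMap.fourier_coe]
  rw [← hψφ]
  have hdom : Integrable fun ξ : EuclideanSpace ℝ (Fin n) =>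
      ‖ψ ξ‖ + (2 * Real.pi) ^ N * (‖ξ‖ ^ N * ‖ψ ξ‖) :=
    ψ.integrable.norm.add ((ψ.integrable_pow_mul volume N).const_mul _)
  have hc : Continuous fun ξ : EuclideanSpace ℝ (Fin n) =>
      (((2 * Real.pi * ‖ξ‖) ^ s : ℝ) : ℂ) * ψ ξ := by
    have : Continuous fun ξ : EuclideanSpace ℝ (Fin n) => (2 * Real.pi * ‖ξ‖) ^ s :=
      (by fun_prop : Continuous fun ξ : EuclideanSpace ℝ (Fin n) => 2 * Real.pi * ‖ξ‖).rpow_const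
        fun _ => Or.inr hs
    exact (Complex.continuous_ofReal.comp this).mul ψ.continuous
  refine hdom.mono' hc.aestronglyMeasurable (ae_of_all _ fun ξ => ?_)
  have h0 : 0 ≤ 2 * Real.pi * ‖ξ‖ := by positivity
  rw [norm_mul, Complex.norm_real, Real.norm_of_nonneg (Real.rpow_nonneg h0 _)]
  have h1 : (2 * Real.pi * ‖ξ‖) ^ s ≤ 1 + (2 * Real.pi * ‖ξ‖) ^ N := by
    rcases le_total (2 * Real.pi * ‖ξ‖) 1 with h | h
    · have := Real.rpow_le_one h0 h hs
      have : 0 ≤ (2 * Real.pi * ‖ξ‖) ^ N := by positivity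
      linarith
    · have := Real.rpow_le_rpow_of_exponent_le h hN
      rw [Real.rpow_natCast] at this
      linarith
  calc _ ≤ (1 + (2 * Real.pi * ‖ξ‖) ^ N) * ‖ψ ξ‖ := by gcongr
    _ = _ := by rw [mul_pow]; ring

/-- A splitting of the symbol gives a splitting of the operator. -/
lemma schwartzLambda_eq_of_splitting {σ s : ℝ} (hs : 0 ≤ s) {a b : ℂ}
    {K L : EuclideanSpace ℝ (Fin n) → ℂ} (hK : Integrable K) (hL : Integrable L)
    (h : ∀ ξ, (((2 * Real.pi * ‖ξ‖) ^ σ : ℝ) : ℂ) =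
      a * 𝓕 K ξ + b * (𝓕 L ξ * (((2 * Real.pi * ‖ξ‖) ^ s : ℝ) : ℂ)))
    (φ : 𝓢(EuclideanSpace ℝ (Fin n), ℂ)) (x : EuclideanSpace ℝ (Fin n)) :
    schwartzLambda σ φ x =
      a * (∫ y, K y * φ (x - y)) + b * ∫ y, L y * schwartzLambda s φ (x - y) := by
  have hφ : Integrable (𝓕 (φ : EuclideanSpace ℝ (Fin n) → ℂ)) := by
    rw [← SchwartzMap.fourier_coe]; exact (𝓕 φ).integrable
  have hs' := symbol_mul_fourier_integrable hs φ
  have hinv : 𝓕⁻ (𝓕 (φ : EuclideanSpace ℝ (Fin n) → ℂ)) = φ := by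
    rw [← SchwartzMap.fourier_coe, ← SchwartzMap.fourierInv_coe,
      FourierTransform.fourierInv_fourier_eq]
  have e : (fun ξ : EuclideanSpace ℝ (Fin n) =>
      (((2 * Real.pi * ‖ξ‖) ^ σ : ℝ) : ℂ) * 𝓕 (φ : EuclideanSpace ℝ (Fin n) → ℂ) ξ) =
      fun ξ => a * (𝓕 K ξ * 𝓕 (φ : EuclideanSpace ℝ (Fin n) → ℂ) ξ) +
        b * (𝓕 L ξ * ((((2 * Real.pi * ‖ξ‖) ^ s : ℝ) : ℂ) *
          𝓕 (φ : EuclideanSpace ℝ (Fin n) → ℂ) ξ)) := by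
    ext ξ
    rw [h ξ]
    ring
  unfold schwartzLambda
  rw [e, fourierInv_linear_combination (fourier_mul_integrable hK hφ)
    (fourier_mul_integrable hL hs'), fourierInv_fourier_mul hK hφ, fourierInv_fourier_mul hL hs',
    hinv]

lemma schwartzLambda_translate (s : ℝ) (φ : 𝓢(EuclideanSpace ℝ (Fin n), ℂ))
    (y x : EuclideanSpace ℝ (Fin n)) :
    schwartzLambda s (φ.compSubConstCLM ℂ y) x = schwartzLambda s φ (x - y) := by
  have hF : ∀ ξ, 𝓕 (φ.compSubConstCLM ℂ y : EuclideanSpace ℝ (Fin n) → ℂ) ξ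
      = Real.fourierChar (-inner ℝ y ξ) • 𝓕 (φ : EuclideanSpace ℝ (Fin n) → ℂ) ξ := by
    intro ξ
    rw [Real.fourier_eq, Real.fourier_eq, ← integral_sub_right_eq_self
      (fun v => Real.fourierChar (-inner ℝ v ξ) • φ v) y, Circle.smul_def,
      ← integral_smul]
    refine integral_congr_ae (ae_of_all _ fun v => ?_)
    have : Real.fourierChar (-inner ℝ v ξ)
        = Real.fourierChar (-inner ℝ y ξ) * Real.fourierChar (-inner ℝ (v - y) ξ) := by
      rw [← AddChar.map_add_eq_mul, inner_sub_left]
      congr 1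
      ring
    simp only [this, SchwartzMap.compSubConstCLM_apply, Circle.smul_def, Circle.coe_mul,
      smul_eq_mul]
    ring
  unfold schwartzLambda
  rw [Real.fourierInv_eq, Real.fourierInv_eq]
  refine integral_congr_ae (ae_of_all _ fun ξ => ?_)
  have : Real.fourierChar (inner ℝ ξ (x - y))
      = Real.fourierChar (inner ℝ ξ x) * Real.fourierChar (-inner ℝ y ξ) := by
    rw [← AddChar.map_add_eq_mul, inner_sub_right, real_inner_comm y ξ, sub_eq_add_neg]
  simp only [this, hF, Circle.smul_def, Circle.coe_mul, smul_eq_mul]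
  ring

/-! ### Integrable bounded functions -/

/-- Membership in `L¹ ∩ L^∞`, with a pointwise bound. -/
def IntegrableBounded (ψ : EuclideanSpace ℝ (Fin n) → ℂ) : Prop :=
  Integrable ψ ∧ ∃ B : ℝ≥0, 0 < B ∧ ∀ x, ‖ψ x‖ₑ ≤ B

lemma SchwartzMap.integrableBounded (φ : 𝓢(EuclideanSpace ℝ (Fin n), ℂ)) :
    IntegrableBounded (φ : EuclideanSpace ℝ (Fin n) → ℂ) := by
  refine ⟨φ.integrable, (SchwartzMap.seminorm ℝ 0 0 φ).toNNReal + 1, by positivity, fun x => ?_⟩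
  rw [enorm_eq_nnnorm, ENNReal.coe_le_coe, ← NNReal.coe_le_coe]
  have := φ.norm_le_seminorm ℝ x
  push_cast
  have := Real.le_coe_toNNReal (SchwartzMap.seminorm ℝ 0 0 φ)
  linarith

lemma IntegrableBounded.convolution {K ψ : EuclideanSpace ℝ (Fin n) → ℂ} (hK : Integrable K)
    (hψ : IntegrableBounded ψ) : IntegrableBounded fun x => ∫ y, K y * ψ (x - y) := by
  obtain ⟨hi, B, hB, hb⟩ := hψ
  refine ⟨hK.integrable_convolution (ContinuousLinearMap.mul ℂ ℂ) hi,
    (∫⁻ y, ‖K y‖ₑ).toNNReal * B + B, by positivity, fun x => ?_⟩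
  calc ‖∫ y, K y * ψ (x - y)‖ₑ ≤ ∫⁻ y, ‖K y * ψ (x - y)‖ₑ := enorm_integral_le_lintegral_enorm _
    _ ≤ ∫⁻ y, ‖K y‖ₑ * B := by
        refine lintegral_mono fun y => ?_
        rw [enorm_mul]
        gcongr
        exact hb _
    _ = (∫⁻ y, ‖K y‖ₑ) * B := lintegral_mul_const' _ _ (by simp)
    _ ≤ _ := by
        push_cast
        rw [ENNReal.coe_toNNReal hK.2.ne]
        exact le_self_add

lemma IntegrableBounded.linear_combination {f g : EuclideanSpace ℝ (Fin n) → ℂ}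
    (hf : IntegrableBounded f) (hg : IntegrableBounded g) (a b : ℂ) :
    IntegrableBounded fun x => a * f x + b * g x := by
  obtain ⟨hi, B, hB, hb⟩ := hf
  obtain ⟨hi', B', hB', hb'⟩ := hg
  refine ⟨(hi.const_mul a).add (hi'.const_mul b), ‖a‖₊ * B + ‖b‖₊ * B' + 1, by positivity,
    fun x => ?_⟩
  calc ‖a * f x + b * g x‖ₑ ≤ ‖a‖ₑ * ‖f x‖ₑ + ‖b‖ₑ * ‖g x‖ₑ := by
        rw [← enorm_mul, ← enorm_mul]; exact enorm_add_le _ _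
    _ ≤ ‖a‖ₑ * B + ‖b‖ₑ * B' := by gcongr <;> solve_by_elim
    _ ≤ _ := by push_cast; exact le_self_add

/-- For an even integer order, `Λ^s φ` is a Schwartz function. -/
lemma schwartzLambda_even_integrableBounded (N : ℕ) (φ : 𝓢(EuclideanSpace ℝ (Fin n), ℂ)) :
    IntegrableBounded (schwartzLambda ((2 * N : ℕ) : ℝ) φ) := by
  have hg : (fun ξ : EuclideanSpace ℝ (Fin n) =>
      (((2 * Real.pi) ^ 2 * ‖ξ‖ ^ 2) ^ N : ℝ)).HasTemperateGrowth :=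
    ((Function.HasTemperateGrowth.const _).mul
      (Function.hasTemperateGrowth_norm_sq (EuclideanSpace ℝ (Fin n)))).pow N
  set χ : 𝓢(EuclideanSpace ℝ (Fin n), ℂ) := SchwartzMap.smulLeftCLM ℂ
    (fun ξ : EuclideanSpace ℝ (Fin n) => (((2 * Real.pi) ^ 2 * ‖ξ‖ ^ 2) ^ N : ℝ)) (𝓕 φ) with hχ
  have : schwartzLambda ((2 * N : ℕ) : ℝ) φ = (𝓕⁻ χ : 𝓢(EuclideanSpace ℝ (Fin n), ℂ)) := by
    rw [SchwartzMap.fourierInv_coe]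
    unfold schwartzLambda
    congr 1
    ext ξ
    rw [hχ, SchwartzMap.smulLeftCLM_apply_apply hg, Real.rpow_natCast, pow_mul, mul_pow,
      SchwartzMap.fourier_coe, Complex.real_smul]
  rw [this]
  exact SchwartzMap.integrableBounded _

lemma schwartzLambda_integrableBounded {σ : ℝ} (hσ : 0 < σ)
    (φ : 𝓢(EuclideanSpace ℝ (Fin n), ℂ)) : IntegrableBounded (schwartzLambda σ φ) := by
  obtain ⟨N, hN⟩ := exists_nat_gt σ
  have hlt : σ < ((2 * N : ℕ) : ℝ) := by push_cast; linarith
  obtain ⟨K, L, hK, hL, h⟩ := exists_fourier_splitting_scale (n := n) hσ hlt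
  have e := schwartzLambda_eq_of_splitting (hσ.trans hlt).le (dilate_integrable one_pos hK)
    (dilate_integrable one_pos hL) (h 1 one_pos) φ
  rw [funext e]
  exact (φ.integrableBounded.convolution (dilate_integrable one_pos hK)).linear_combination
    ((schwartzLambda_even_integrableBounded N φ).convolution (dilate_integrable one_pos hL)) _ _

/-! ### Duality between convolution operators -/

/-- The correlation `x ↦ ∫ K(y) f(x + y) dy`, the transpose of convolution with `K`. -/
noncomputable def correlation (K f : EuclideanSpace ℝ (Fin n) → ℂ) :
    EuclideanSpace ℝ (Fin n) → ℂ :=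
  fun x => ∫ y, K y * f (x + y)

lemma lintegral_enorm_mul_lt_top {f ψ : EuclideanSpace ℝ (Fin n) → ℂ}
    (hf : ∀ τ : ℝ≥0∞, τ ≠ ∞ → kFunctional f τ < ∞) (hψ : IntegrableBounded ψ) :
    ∃ M : ℝ≥0∞, M < ∞ ∧ ∀ y, ∫⁻ x, ‖f x * ψ (x - y)‖ₑ ≤ M := by
  obtain ⟨hi, B, hB, hb⟩ := hψ
  refine ⟨B * kFunctional f ((B : ℝ≥0∞)⁻¹ * ∫⁻ x, ‖ψ x‖ₑ), ENNReal.mul_lt_top (by simp)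
    (hf _ (ENNReal.mul_ne_top (by simpa using hB.ne') hi.2.ne)), fun y => ?_⟩
  have hm : AEMeasurable fun x => ‖ψ (x - y)‖ₑ := (hi.comp_sub_right y).1.enorm
  have := lintegral_mul_enorm_le_kFunctional f hm hB fun x => hb _
  rw [lintegral_sub_right_eq_self (fun x => ‖ψ x‖ₑ) y] at this
  refine le_trans (le_of_eq ?_) this
  simp_rw [enorm_mul, mul_comm]

lemma integrable_mul_of_kFunctional {f ψ : EuclideanSpace ℝ (Fin n) → ℂ}
    (hfm : AEStronglyMeasurable f) (hf : ∀ τ : ℝ≥0∞, τ ≠ ∞ → kFunctional f τ < ∞)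
    (hψ : IntegrableBounded ψ) : Integrable fun x => f x * ψ x := by
  obtain ⟨M, hM, h⟩ := lintegral_enorm_mul_lt_top hf hψ
  exact ⟨hfm.mul hψ.1.1, by simpa [HasFiniteIntegral] using (h 0).trans_lt hM⟩

lemma integrable_prod_of_lintegral_le
    {F : EuclideanSpace ℝ (Fin n) × EuclideanSpace ℝ (Fin n) → ℂ}
    (hF : AEStronglyMeasurable F (volume.prod volume)) {K : EuclideanSpace ℝ (Fin n) → ℂ}
    (hK : Integrable K) {M : ℝ≥0∞} (hM : M < ∞)
    (h : ∀ y, ∫⁻ x, ‖F (x, y)‖ₑ ≤ ‖K y‖ₑ * M) : Integrable F (volume.prod volume) := by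
  refine ⟨hF, ?_⟩
  unfold HasFiniteIntegral
  rw [lintegral_prod_symm _ hF.enorm]
  calc _ ≤ ∫⁻ y, ‖K y‖ₑ * M := lintegral_mono h
    _ = (∫⁻ y, ‖K y‖ₑ) * M := lintegral_mul_const' _ _ hM.ne
    _ < ∞ := ENNReal.mul_lt_top hK.2 hM

lemma aestronglyMeasurable_comp_add {f : EuclideanSpace ℝ (Fin n) → ℂ}
    (hf : AEStronglyMeasurable f) :
    AEStronglyMeasurable (fun z : EuclideanSpace ℝ (Fin n) × EuclideanSpace ℝ (Fin n) =>
      f (z.1 + z.2)) (volume.prod volume) :=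
  hf.comp_quasiMeasurePreserving (quasiMeasurePreserving_add _ _)

lemma aestronglyMeasurable_comp_sub {f : EuclideanSpace ℝ (Fin n) → ℂ}
    (hf : AEStronglyMeasurable f) :
    AEStronglyMeasurable (fun z : EuclideanSpace ℝ (Fin n) × EuclideanSpace ℝ (Fin n) =>
      f (z.1 - z.2)) (volume.prod volume) :=
  hf.comp_quasiMeasurePreserving (quasiMeasurePreserving_sub _ _)

lemma correlation_aestronglyMeasurable {K f : EuclideanSpace ℝ (Fin n) → ℂ}
    (hK : AEStronglyMeasurable K) (hf : AEStronglyMeasurable f) :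
    AEStronglyMeasurable (correlation K f) :=
  (hK.comp_snd.mul (aestronglyMeasurable_comp_add hf)).integral_prod_right'

/-- Correlation with an integrable kernel is an average of translations, so that it increases the
K-functional by a factor of at most the `L¹` norm of the kernel. -/
lemma kFunctional_correlation_le {K f : EuclideanSpace ℝ (Fin n) → ℂ}
    (hK : AEStronglyMeasurable K) (hf : AEStronglyMeasurable f) (τ : ℝ≥0∞) :
    kFunctional (correlation K f) τ ≤ (∫⁻ y, ‖K y‖ₑ) * kFunctional f τ := by
  refine kFunctional_le fun w hw h1 hτ => ?_
  have hm := (hK.comp_snd (μ := volume)).mul (aestronglyMeasurable_comp_add hf)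
  calc ∫⁻ x, w x * ‖correlation K f x‖ₑ
      ≤ ∫⁻ x, ∫⁻ y, w x * ‖K y * f (x + y)‖ₑ := by
        refine lintegral_mono fun x => ?_
        rw [lintegral_const_mul' _ _ (ne_top_of_le_ne_top ENNReal.one_ne_top (h1 x))]
        gcongr
        exact enorm_integral_le_lintegral_enorm _
    _ = ∫⁻ y, ∫⁻ x, w x * ‖K y * f (x + y)‖ₑ :=
        lintegral_lintegral_swap (hw.comp_fst.mul hm.enorm)
    _ ≤ ∫⁻ y, ‖K y‖ₑ * kFunctional f τ := by
        refine lintegral_mono fun y => ?_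
        have hwy : AEMeasurable fun x => w (x - y) :=
          hw.comp_quasiMeasurePreserving
            (measurePreserving_sub_right volume y).quasiMeasurePreserving
        have hle := le_kFunctional f hwy (fun x => h1 _)
          ((lintegral_sub_right_eq_self w y).trans_le hτ)
        rw [← lintegral_add_right_eq_self _ y] at hle
        calc ∫⁻ x, w x * ‖K y * f (x + y)‖ₑ = ∫⁻ x, ‖K y‖ₑ * (w x * ‖f (x + y)‖ₑ) := by
              simp_rw [enorm_mul, mul_left_comm]
          _ = ‖K y‖ₑ * ∫⁻ x, w x * ‖f (x + y)‖ₑ := lintegral_const_mul' _ _ enorm_ne_top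
          _ ≤ _ := by
              gcongr
              simpa using hle
    _ = _ := lintegral_mul_const'' _ hK.enorm

/-- The correlation and the convolution with `K` are transposes of each other: this lemma and
`integral_mul_convolution` give the same value to both pairings. -/
lemma integral_correlation_mul {K f ψ : EuclideanSpace ℝ (Fin n) → ℂ} (hK : Integrable K)
    (hfm : AEStronglyMeasurable f) (hf : ∀ τ : ℝ≥0∞, τ ≠ ∞ → kFunctional f τ < ∞)
    (hψ : IntegrableBounded ψ) :
    ∫ x, correlation K f x * ψ x = ∫ y, K y * ∫ x, f x * ψ (x - y) := by
  obtain ⟨M, hM, h⟩ := lintegral_enorm_mul_lt_top hf hψ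
  have hint : Integrable (fun z : EuclideanSpace ℝ (Fin n) × EuclideanSpace ℝ (Fin n) =>
      K z.2 * f (z.1 + z.2) * ψ z.1) (volume.prod volume) := by
    refine integrable_prod_of_lintegral_le
      ((hK.1.comp_snd.mul (aestronglyMeasurable_comp_add hfm)).mul hψ.1.1.comp_fst) hK hM
      fun y => ?_
    calc ∫⁻ x, ‖K y * f (x + y) * ψ x‖ₑ = ∫⁻ x, ‖K y‖ₑ * ‖f (x + y) * ψ (x + y - y)‖ₑ := by
          simp_rw [mul_assoc, enorm_mul, add_sub_cancel_right]
      _ = ‖K y‖ₑ * ∫⁻ x, ‖f (x + y) * ψ (x + y - y)‖ₑ := lintegral_const_mul' _ _ enorm_ne_top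
      _ ≤ _ := by
          rw [lintegral_add_right_eq_self (fun x => ‖f x * ψ (x - y)‖ₑ) y]
          gcongr
          exact h y
  calc ∫ x, correlation K f x * ψ x = ∫ x, ∫ y, K y * f (x + y) * ψ x := by
        simp only [correlation, integral_mul_const]
    _ = ∫ y, ∫ x, K y * f (x + y) * ψ x := integral_integral_swap hint
    _ = _ := by
        refine integral_congr_ae (ae_of_all _ fun y => ?_)
        simp only [mul_assoc, integral_const_mul]
        rw [← integral_add_right_eq_self (fun x => f x * ψ (x - y)) y]
        simp

lemma integral_mul_convolution {K f ψ : EuclideanSpace ℝ (Fin n) → ℂ} (hK : Integrable K)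
    (hfm : AEStronglyMeasurable f) (hf : ∀ τ : ℝ≥0∞, τ ≠ ∞ → kFunctional f τ < ∞)
    (hψ : IntegrableBounded ψ) :
    ∫ x, f x * ∫ y, K y * ψ (x - y) = ∫ y, K y * ∫ x, f x * ψ (x - y) := by
  obtain ⟨M, hM, h⟩ := lintegral_enorm_mul_lt_top hf hψ
  have hint : Integrable (fun z : EuclideanSpace ℝ (Fin n) × EuclideanSpace ℝ (Fin n) =>
      K z.2 * (f z.1 * ψ (z.1 - z.2))) (volume.prod volume) := by
    refine integrable_prod_of_lintegral_le
      (hK.1.comp_snd.mul (hfm.comp_fst.mul (aestronglyMeasurable_comp_sub hψ.1.1))) hK hM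
      fun y => ?_
    simp_rw [enorm_mul (K y)]
    rw [lintegral_const_mul' _ _ enorm_ne_top]
    gcongr
    exact h y
  calc ∫ x, f x * ∫ y, K y * ψ (x - y) = ∫ x, ∫ y, K y * (f x * ψ (x - y)) := by
        simp only [← integral_const_mul, mul_left_comm]
    _ = ∫ y, ∫ x, K y * (f x * ψ (x - y)) := integral_integral_swap hint
    _ = _ := by simp only [integral_const_mul]

end Convolution

/-! ### The fractional derivative of intermediate order -/

/-- Optimisation over the scale: the two terms balance at `A = (α / β)^{1/s}`. -/
lemma le_of_forall_scale {x α β σ s : ℝ} (hσ : 0 < σ) (hσs : σ < s) (hα : 0 ≤ α) (hβ : 0 ≤ β)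
    (h : ∀ A : ℝ, 0 < A → x ≤ A ^ (-σ) * α + A ^ (s - σ) * β) :
    x ≤ 2 * (α ^ (1 - σ / s) * β ^ (σ / s)) := by
  have hs : 0 < s := hσ.trans hσs
  have hθ : 0 < σ / s := by positivity
  have hθ1 : 0 < 1 - σ / s := by rw [sub_pos, div_lt_one hs]; exact hσs
  have hpos : ∀ α β : ℝ, 0 < α → 0 < β → (∀ A : ℝ, 0 < A → x ≤ A ^ (-σ) * α + A ^ (s - σ) * β) →
      x ≤ 2 * (α ^ (1 - σ / s) * β ^ (σ / s)) := by
    intro α β hα hβ h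
    have hA := h ((α / β) ^ (1 / s)) (by positivity)
    rw [← Real.rpow_mul (by positivity), ← Real.rpow_mul (by positivity),
      Real.div_rpow hα.le hβ.le, Real.div_rpow hα.le hβ.le] at hA
    have e1 : 1 / s * -σ = -(σ / s) := by ring
    have e2 : 1 / s * (s - σ) = 1 - σ / s := by field_simp
    rw [e1, e2] at hA
    have e3 : α ^ (-(σ / s)) / β ^ (-(σ / s)) * α = α ^ (1 - σ / s) * β ^ (σ / s) := by
      rw [Real.rpow_neg hβ.le, sub_eq_add_neg, Real.rpow_add hα, Real.rpow_one]
      field_simp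
    have e4 : α ^ (1 - σ / s) / β ^ (1 - σ / s) * β = α ^ (1 - σ / s) * β ^ (σ / s) := by
      rw [sub_eq_add_neg 1, Real.rpow_add hβ, Real.rpow_one, Real.rpow_neg hβ.le]
      have : β ^ (σ / s) ≠ 0 := by positivity
      field_simp
    linarith
  -- The degenerate cases `α = 0` and `β = 0` follow by perturbing both numbers.
  have hlim : Filter.Tendsto
      (fun ε : ℝ => 2 * ((α + ε) ^ (1 - σ / s) * (β + ε) ^ (σ / s))) (nhdsWithin 0 (Ioi 0))
      (nhds (2 * (α ^ (1 - σ / s) * β ^ (σ / s)))) := by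
    have : Continuous fun ε : ℝ => 2 * ((α + ε) ^ (1 - σ / s) * (β + ε) ^ (σ / s)) :=
      continuous_const.mul
        (((continuous_const.add continuous_id).rpow_const fun _ => Or.inr hθ1.le).mul
          ((continuous_const.add continuous_id).rpow_const fun _ => Or.inr hθ.le))
    have := (this.tendsto 0).mono_left (nhdsWithin_le_nhds (s := Ioi 0))
    simpa using this
  refine ge_of_tendsto hlim ?_
  filter_upwards [self_mem_nhdsWithin] with ε hε
  have hε0 : 0 < ε := hε
  refine hpos _ _ (by positivity) (by positivity) fun A hA => (h A hA).trans ?_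
  gcongr <;> linarith

lemma ENNReal.le_of_forall_scale {x α β : ℝ≥0∞} {σ s : ℝ} (hσ : 0 < σ) (hσs : σ < s)
    (hα : α ≠ ∞) (hβ : β ≠ ∞)
    (h : ∀ A : ℝ, 0 < A → x ≤ ENNReal.ofReal (A ^ (-σ)) * α + ENNReal.ofReal (A ^ (s - σ)) * β) :
    x ≤ 2 * (α ^ (1 - σ / s) * β ^ (σ / s)) := by
  have hs : 0 < s := hσ.trans hσs
  have hθ : 0 ≤ σ / s := by positivity
  have hθ1 : 0 ≤ 1 - σ / s := by rw [sub_nonneg, div_le_one hs]; exact hσs.le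
  lift α to ℝ≥0 using hα
  lift β to ℝ≥0 using hβ
  have hx : x ≠ ∞ := ne_top_of_le_ne_top (by
    exact ENNReal.add_ne_top.2 ⟨ENNReal.mul_ne_top (by simp) (by simp),
      ENNReal.mul_ne_top (by simp) (by simp)⟩) (h 1 one_pos)
  lift x to ℝ≥0 using hx
  have key := _root_.le_of_forall_scale (x := x) (α := α) (β := β) hσ hσs α.2 β.2 fun A hA => by
    have hA' := h A hA
    rw [ENNReal.ofReal, ENNReal.ofReal] at hA'
    norm_cast at hA'
    have := NNReal.coe_le_coe.2 hA'
    push_cast at this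
    rwa [Real.coe_toNNReal _ (Real.rpow_nonneg hA.le _),
      Real.coe_toNNReal _ (Real.rpow_nonneg hA.le _)] at this
  rw [← ENNReal.coe_rpow_of_nonneg _ hθ1, ← ENNReal.coe_rpow_of_nonneg _ hθ]
  exact_mod_cast key

section IntermediateDerivative

variable {n : ℕ}

/-- The candidate for `Λ^σ u` given by the splitting of the symbol at the scale `A`, with
`g = Λ^s u`. -/
noncomputable def intermediateDerivative (σ s A : ℝ) (K L u g : EuclideanSpace ℝ (Fin n) → ℂ) :
    EuclideanSpace ℝ (Fin n) → ℂ :=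
  fun x => ((A ^ (-σ) : ℝ) : ℂ) * correlation (dilate A K) u x +
    ((A ^ (s - σ) : ℝ) : ℂ) * correlation (dilate A L) g x

lemma intermediateDerivative_aestronglyMeasurable (σ s : ℝ) {A : ℝ} (hA : 0 < A)
    {K L u g : EuclideanSpace ℝ (Fin n) → ℂ} (hK : Integrable K) (hL : Integrable L)
    (hu : AEStronglyMeasurable u) (hg : AEStronglyMeasurable g) :
    AEStronglyMeasurable (intermediateDerivative σ s A K L u g) :=
  ((correlation_aestronglyMeasurable (dilate_integrable hA hK).1 hu).const_mul _).add
    ((correlation_aestronglyMeasurable (dilate_integrable hA hL).1 hg).const_mul _)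

lemma lintegral_enorm_dilate {A : ℝ} (hA : 0 < A) {K : EuclideanSpace ℝ (Fin n) → ℂ}
    (hK : Integrable K) : ∫⁻ x, ‖dilate A K x‖ₑ = ∫⁻ x, ‖K x‖ₑ := by
  rw [← ofReal_integral_norm_eq_lintegral_enorm (dilate_integrable hA hK),
    ← ofReal_integral_norm_eq_lintegral_enorm hK, integral_norm_dilate hA]

lemma kFunctional_intermediateDerivative_le (σ s : ℝ) {A : ℝ} (hA : 0 < A)
    {K L u g : EuclideanSpace ℝ (Fin n) → ℂ} (hK : Integrable K) (hL : Integrable L)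
    (hu : AEStronglyMeasurable u) (hg : AEStronglyMeasurable g) (τ : ℝ≥0∞) :
    kFunctional (intermediateDerivative σ s A K L u g) τ ≤
      ENNReal.ofReal (A ^ (-σ)) * ((∫⁻ x, ‖K x‖ₑ) * kFunctional u τ) +
        ENNReal.ofReal (A ^ (s - σ)) * ((∫⁻ x, ‖L x‖ₑ) * kFunctional g τ) := by
  have hnorm : ∀ a : ℝ, ‖((A ^ a : ℝ) : ℂ)‖ₑ = ENNReal.ofReal (A ^ a) := fun a => by
    rw [← ofReal_norm, Complex.norm_real, Real.norm_of_nonneg (Real.rpow_nonneg hA.le _)]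
  have hKm := (dilate_integrable hA hK).1
  have hLm := (dilate_integrable hA hL).1
  refine (kFunctional_add_le
    ((correlation_aestronglyMeasurable hKm hu).const_mul _) τ).trans (add_le_add ?_ ?_)
  · refine (kFunctional_const_mul_le _ _ τ).trans ?_
    rw [hnorm, ← lintegral_enorm_dilate hA hK]
    gcongr
    exact kFunctional_correlation_le hKm hu τ
  · refine (kFunctional_const_mul_le _ _ τ).trans ?_
    rw [hnorm, ← lintegral_enorm_dilate hA hL]
    gcongr
    exact kFunctional_correlation_le hLm hg τ

/-- The candidate represents `Λ^σ u`. The kernel `L` acts on `g = Λ^s u` through translations of the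
test function, and these commute with `Λ^s`. -/
lemma isLambda_intermediateDerivative {σ s : ℝ} (hσ : 0 < σ) (hσs : σ < s) {A : ℝ} (hA : 0 < A)
    {K L u g : EuclideanSpace ℝ (Fin n) → ℂ} (hK : Integrable K) (hL : Integrable L)
    (hsplit : ∀ ξ, (((2 * Real.pi * ‖ξ‖) ^ σ : ℝ) : ℂ) =
      ((A ^ (-σ) : ℝ) : ℂ) * 𝓕 (dilate A K) ξ +
        ((A ^ (s - σ) : ℝ) : ℂ) * (𝓕 (dilate A L) ξ * (((2 * Real.pi * ‖ξ‖) ^ s : ℝ) : ℂ)))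
    (hum : AEStronglyMeasurable u) (hu : ∀ τ : ℝ≥0∞, τ ≠ ∞ → kFunctional u τ < ∞)
    (hgm : AEStronglyMeasurable g) (hg : ∀ τ : ℝ≥0∞, τ ≠ ∞ → kFunctional g τ < ∞)
    (hug : IsLambda s u g) : IsLambda σ u (intermediateDerivative σ s A K L u g) := by
  have hs : 0 < s := hσ.trans hσs
  have hKA := dilate_integrable hA hK
  have hLA := dilate_integrable hA hL
  have hcK : ∀ τ : ℝ≥0∞, τ ≠ ∞ → kFunctional (correlation (dilate A K) u) τ < ∞ := fun τ hτ =>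
    (kFunctional_correlation_le hKA.1 hum τ).trans_lt (ENNReal.mul_lt_top hKA.2 (hu τ hτ))
  have hcL : ∀ τ : ℝ≥0∞, τ ≠ ∞ → kFunctional (correlation (dilate A L) g) τ < ∞ := fun τ hτ =>
    (kFunctional_correlation_le hLA.1 hgm τ).trans_lt (ENNReal.mul_lt_top hLA.2 (hg τ hτ))
  have hcKm := correlation_aestronglyMeasurable hKA.1 hum
  have hcLm := correlation_aestronglyMeasurable hLA.1 hgm
  have hhm := intermediateDerivative_aestronglyMeasurable σ s hA hK hL hum hgm
  have hh : ∀ τ : ℝ≥0∞, τ ≠ ∞ → kFunctional (intermediateDerivative σ s A K L u g) τ < ∞ :=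
    fun τ hτ => (kFunctional_intermediateDerivative_le σ s hA hK hL hum hgm τ).trans_lt
      (ENNReal.add_lt_top.2 ⟨ENNReal.mul_lt_top (by simp) (ENNReal.mul_lt_top hK.2 (hu τ hτ)),
        ENNReal.mul_lt_top (by simp) (ENNReal.mul_lt_top hL.2 (hg τ hτ))⟩)
  refine ⟨locallyIntegrable_of_kFunctional_lt_top hhm hh, fun φ =>
    ⟨integrable_mul_of_kFunctional hum hu (schwartzLambda_integrableBounded hσ φ),
      integrable_mul_of_kFunctional hhm hh φ.integrableBounded, ?_⟩⟩
  have hφ := φ.integrableBounded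
  have hsφ := schwartzLambda_integrableBounded hs φ
  have htrans : ∀ y, ∫ x, g x * φ (x - y) = ∫ x, u x * schwartzLambda s φ (x - y) := fun y => by
    have := (hug.2 (φ.compSubConstCLM ℂ y)).2.2
    simpa only [schwartzLambda_translate, SchwartzMap.compSubConstCLM_apply] using this.symm
  have hi1 := (integrable_mul_of_kFunctional hum hu (hφ.convolution hKA)).const_mul
    ((A ^ (-σ) : ℝ) : ℂ)
  have hi2 := (integrable_mul_of_kFunctional hum hu (hsφ.convolution hLA)).const_mul
    ((A ^ (s - σ) : ℝ) : ℂ)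
  have hi3 := (integrable_mul_of_kFunctional hcKm hcK hφ).const_mul ((A ^ (-σ) : ℝ) : ℂ)
  have hi4 := (integrable_mul_of_kFunctional hcLm hcL hφ).const_mul ((A ^ (s - σ) : ℝ) : ℂ)
  calc ∫ x, u x * schwartzLambda σ φ x
      = ∫ x, (((A ^ (-σ) : ℝ) : ℂ) * (u x * ∫ y, dilate A K y * φ (x - y)) +
          ((A ^ (s - σ) : ℝ) : ℂ) *
            (u x * ∫ y, dilate A L y * schwartzLambda s φ (x - y))) := by
        refine integral_congr_ae (ae_of_all _ fun x => ?_)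
        simp only
        rw [schwartzLambda_eq_of_splitting hs.le hKA hLA hsplit]
        ring
    _ = ((A ^ (-σ) : ℝ) : ℂ) * (∫ x, correlation (dilate A K) u x * φ x) +
          ((A ^ (s - σ) : ℝ) : ℂ) * ∫ x, correlation (dilate A L) g x * φ x := by
        rw [integral_add hi1 hi2, integral_const_mul, integral_const_mul,
          integral_mul_convolution hKA hum hu hφ, integral_mul_convolution hLA hum hu hsφ,
          integral_correlation_mul hKA hum hu hφ, integral_correlation_mul hLA hgm hg hφ]
        simp_rw [htrans]
    _ = ∫ x, intermediateDerivative σ s A K L u g x * φ x := by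
        rw [← integral_const_mul, ← integral_const_mul, ← integral_add hi3 hi4]
        refine integral_congr_ae (ae_of_all _ fun x => ?_)
        simp only [intermediateDerivative]
        ring

lemma IsLambda.ae_eq {s : ℝ} {u g h : EuclideanSpace ℝ (Fin n) → ℂ} (hg : IsLambda s u g)
    (hh : IsLambda s u h) : g =ᵐ[volume] h := by
  refine ae_eq_of_integral_contDiff_smul_eq hg.1 hh.1 fun w hw hwc => ?_
  have hwC : HasCompactSupport fun x => (w x : ℂ) := hwc.comp_left Complex.ofReal_zero
  set φ := hwC.toSchwartzMap (Complex.ofRealCLM.contDiff.comp hw)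
  have hφw : ∀ x, φ x = (w x : ℂ) := fun x => rfl
  have h1 := (hg.2 φ).2.2
  rw [(hh.2 φ).2.2] at h1
  simp_rw [hφw] at h1
  simpa [mul_comm] using h1.symm

end IntermediateDerivative

theorem proposition3p2 (n : ℕ) (hn : 1 ≤ n) (q r q₁ r₁ : ℝ≥0∞)
    (hq : 1 < q) (hr : 1 < r) (hq₁ : 1 ≤ q₁) (hr₁ : 1 ≤ r₁)
    (σ s : ℝ) (hσ : 0 < σ) (hσs : σ < s) (p p₁ : ℝ≥0∞)
    (hp : p⁻¹ = ENNReal.ofReal (1 - σ / s) * q⁻¹ + ENNReal.ofReal (σ / s) * r⁻¹)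
    (hp₁ : p₁⁻¹ = ENNReal.ofReal (1 - σ / s) * q₁⁻¹ + ENNReal.ofReal (σ / s) * r₁⁻¹) :
    ∃ C : ℝ≥0, 0 < C ∧
      ∀ u Λsu : EuclideanSpace ℝ (Fin n) → ℂ,
        MemLorentz u q q₁ → IsLambda s u Λsu → MemLorentz Λsu r r₁ →
        ∃ Λσu : EuclideanSpace ℝ (Fin n) → ℂ,
          IsLambda σ u Λσu ∧ MemLorentz Λσu p p₁ ∧
          lorentzNorm Λσu p p₁ ≤
            C * lorentzNorm u q q₁ ^ (1 - σ / s) * lorentzNorm Λsu r r₁ ^ (σ / s) := by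
  have hs : 0 < s := hσ.trans hσs
  have hθ : 0 < σ / s := by positivity
  have hθ1 : σ / s < 1 := (div_lt_one hs).2 hσs
  have hθ' : 0 < 1 - σ / s := by linarith
  obtain ⟨K, L, hK, hL, hsplit⟩ := exists_fourier_splitting_scale (n := n) hσ hσs
  set a := ∫⁻ x, ‖K x‖ₑ with ha
  set b := ∫⁻ x, ‖L x‖ₑ with hb
  have hat : a ≠ ∞ := hK.2.ne
  have hbt : b ≠ ∞ := hL.2.ne
  have hc : 2 * (a ^ (1 - σ / s) * b ^ (σ / s)) ≠ ∞ :=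
    ENNReal.mul_ne_top (by simp) (ENNReal.mul_ne_top (ENNReal.rpow_ne_top_of_nonneg hθ'.le hat)
      (ENNReal.rpow_ne_top_of_nonneg hθ.le hbt))
  obtain ⟨C, hC, hmain⟩ := exists_lorentzNorm_le_of_kFunctional_le (n := n) hq hr hq₁ hr₁ hθ hθ1
    hp hp₁ hc
  refine ⟨C.toNNReal + 1, by positivity, fun u g hu hug hg => ?_⟩
  have huK : ∀ τ : ℝ≥0∞, τ ≠ ∞ → kFunctional u τ < ∞ := fun τ hτ =>
    hu.kFunctional_lt_top hq hq₁ hτ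
  have hgK : ∀ τ : ℝ≥0∞, τ ≠ ∞ → kFunctional g τ < ∞ := fun τ hτ =>
    hg.kFunctional_lt_top hr hr₁ hτ
  have hΛ : ∀ A : ℝ, 0 < A → IsLambda σ u (intermediateDerivative σ s A K L u g) := fun A hA =>
    isLambda_intermediateDerivative hσ hσs hA hK hL (hsplit A hA) hu.1 huK hg.1 hgK hug
  set h := intermediateDerivative σ s 1 K L u g with hh
  have hhm : AEStronglyMeasurable h :=
    intermediateDerivative_aestronglyMeasurable σ s one_pos hK hL hu.1 hg.1
  have hle : lorentzNorm h p p₁ ≤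
      C * (lorentzNorm u q q₁ ^ (1 - σ / s) * lorentzNorm g r r₁ ^ (σ / s)) := by
    refine hmain u g h hu.1 hg.1 hhm fun t _ => ?_
    have htu := huK (ENNReal.ofReal t) (by simp)
    have htg := hgK (ENNReal.ofReal t) (by simp)
    calc _ ≤ 2 * ((a * kFunctional u (ENNReal.ofReal t)) ^ (1 - σ / s) *
          (b * kFunctional g (ENNReal.ofReal t)) ^ (σ / s)) := by
          refine ENNReal.le_of_forall_scale hσ hσs (ENNReal.mul_ne_top hat htu.ne)
            (ENNReal.mul_ne_top hbt htg.ne) fun A hA => ?_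
          -- By uniqueness of `Λ^σ u`, the candidates for different scales agree.
          rw [kFunctional_congr_ae ((hΛ 1 one_pos).ae_eq (hΛ A hA))]
          exact kFunctional_intermediateDerivative_le σ s hA hK hL hu.1 hg.1 _
      _ = _ := by
          rw [ENNReal.mul_rpow_of_nonneg _ _ hθ'.le, ENNReal.mul_rpow_of_nonneg _ _ hθ.le]
          ring
  refine ⟨h, hΛ 1 one_pos, ⟨hhm, hle.trans_lt ?_⟩, hle.trans ?_⟩
  · exact ENNReal.mul_lt_top hC.lt_top (ENNReal.mul_lt_top
      (ENNReal.rpow_lt_top_of_nonneg hθ'.le hu.2.ne) (ENNReal.rpow_lt_top_of_nonneg hθ.le hg.2.ne))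
  · rw [mul_assoc]
    gcongr
    push_cast
    rw [ENNReal.coe_toNNReal hC]
    exact le_self_add
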